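/- Let $A=\mathbb{Z}[x_1,\dots,x_n]$, standard graded ($\deg x_i=1$), and let $\mathfrak a\subseteq A$ be a homogeneous ideal such that every nonzero integer is a nonzerodivisor on $A/\mathfrak a$. For a field $\Bbbk$, let $R=\Bbbk[x_1,\dots,x_n]$ and $\mathfrak m=(x_1,\dots,x_n)R$. A minimal graded free resolution of a finitely generated graded $R$-module $M$ is an exact sequence $0\to F_N\to\cdots\to F_1\to F_0\to M\to 0$ in which every $F_i$ is a finitely generated graded free $R$-module, every map is homogeneous of degree $0$, and the image of $F_{i+1}\to F_i$ lies in $\mathfrak m F_i$ for all $i\ge 0$. The graded Betti number $\beta_{i,j}(M)$ is the number of elements of degree $j$ in a homogeneous basis of $F_i$, and the table $\beta^{R}(M)=(\beta_{i,j}(M))_{i\ge 0,\,j\in\mathbb{Z}}$ is the Betti table of $M$. A table $\beta'$ is obtained from a table $\beta$ by a consecutive cancellation if there are $i,j$ such that $\beta'_{i,j}=\beta_{i,j}-1$, $\beta'_{i+1,j}=\beta_{i+1,j}-1$, and all other entries of $\beta'$ and $\beta$ agree (entries being nonnegative integers). Then for every prime $p$, the modules $(A/\mathfrak a)\otimes_{\mathbb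 Z}\mathbb{Q}$ over $\mathbb{Q}[x_1,\dots,x_n]$ and $(A/\mathfrak a)\otimes_{\mathbb Z}\mathbb{F}_p$ over $\mathbb{F}_p[x_1,\dots,x_n]$ have minimal graded free resolutions, and the Betti table $$\beta^{\mathbb{Q}[x_1,\dots,x_n]}\big((A/\mathfrak a)\otimes_{\mathbb Z}\mathbb{Q}\big)$$ computed from any such resolution is obtained from the Betti table $$\beta^{\mathbb{F}_p[x_1,\dots,x_n]}\big((A/\mathfrak a)\otimes_{\mathbb Z}\mathbb{F}_p\big)$$ computed from any such resolution by a finite (possibly empty) sequence of consecutive cancellations. -/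

import Mathlib

open scoped TensorProduct

attribute [local instance] MvPolynomial.gradedAlgebra

noncomputable section

namespace BettiCancellation

/-- The degree `j` part of the standard graded polynomial ring `k[x₁, …, xₙ]`
(`deg xᵢ = 1`), for an arbitrary integer `j`; it is `0` for `j < 0`. -/
abbrev polyDegree (k : Type*) [CommRing k] (n : ℕ) (j : ℤ) :
    Submodule k (MvPolynomial (Fin n) k) :=
  MvPolynomial.weightedHomogeneousSubmodule k (fun _ : Fin n => (1 : ℤ)) j

/-- The ideal `𝔪 = (x₁, …, xₙ)` of `k[x₁, …, xₙ]`. -/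
abbrev maxIdeal (k : Type*) [CommRing k] (n : ℕ) : Ideal (MvPolynomial (Fin n) k) :=
  Ideal.span (Set.range MvPolynomial.X)

/-- With `R = k[x₁, …, xₙ]`, the element `f` of the graded free module `⨁ₛ R(-bₛ)`, whose
`s`-th basis vector has degree `bₛ`, is homogeneous of degree `j`. -/
def IsHomogeneousOfDegree {k : Type*} [CommRing k] {n r : ℕ} (b : Fin r → ℤ) (j : ℤ)
    (f : Fin r → MvPolynomial (Fin n) k) : Prop :=
  ∀ s, f s ∈ polyDegree k n (j - b s)

/-- A minimal graded free resolution `0 → F_N → ⋯ → F₁ → F₀ → M → 0` over `R = k[x₁, …, xₙ]`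
of an `R`-module `M` with graded pieces `ℳ j`. The `i`-th module is
`Fᵢ = ⨁ₛ R(-bᵢₛ)`, with `s` running over `rank i` indices and `bᵢₛ = deg i s`. -/
structure MinimalGradedFreeResolution (k : Type*) [Field k] (n : ℕ) (M : Type*)
    [AddCommGroup M] [Module (MvPolynomial (Fin n) k) M] (ℳ : ℤ → AddSubgroup M) where
  rank : ℕ → ℕ
  deg : ∀ i, Fin (rank i) → ℤ
  /-- the differential from the module with index `i + 1` to the one with index `i` -/
  d : ∀ i, (Fin (rank (i + 1)) → MvPolynomial (Fin n) k) →ₗ[MvPolynomial (Fin n) k]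
    (Fin (rank i) → MvPolynomial (Fin n) k)
  /-- the augmentation, which identifies the cokernel of `d 0` with `M` -/
  ε : (Fin (rank 0) → MvPolynomial (Fin n) k) →ₗ[MvPolynomial (Fin n) k] M
  d_degree_zero : ∀ (i : ℕ) (j : ℤ) (f : Fin (rank (i + 1)) → MvPolynomial (Fin n) k),
    IsHomogeneousOfDegree (deg (i + 1)) j f → IsHomogeneousOfDegree (deg i) j (d i f)
  ε_degree_zero : ∀ (j : ℤ) (f : Fin (rank 0) → MvPolynomial (Fin n) k),
    IsHomogeneousOfDegree (deg 0) j f → ε f ∈ ℳ j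
  minimal : ∀ i, LinearMap.range (d i) ≤
    maxIdeal k n • (⊤ : Submodule (MvPolynomial (Fin n) k) (Fin (rank i) → MvPolynomial (Fin n) k))
  exact : ∀ i, Function.Exact (d (i + 1)) (d i)
  exact_zero : Function.Exact (d 0) ε
  ε_surjective : Function.Surjective ε
  finite_length : ∃ N, ∀ i, N < i → rank i = 0

/-- The graded Betti numbers `β i j` read off from a minimal graded free resolution: the number
of basis elements of degree `j` of the `i`-th free module. -/
def MinimalGradedFreeResolution.betti {k : Type*} [Field k] {n : ℕ} {M : Type*}
    [AddCommGroup M] [Module (MvPolynomial (Fin n) k) M] {ℳ : ℤ → AddSubgroup M}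
    (F : MinimalGradedFreeResolution k n M ℳ) (i : ℕ) (j : ℤ) : ℕ :=
  Fintype.card {s : Fin (F.rank i) // F.deg i s = j}

/-- `β'` is obtained from `β` by one consecutive cancellation. -/
def IsConsecutiveCancellation (β β' : ℕ → ℤ → ℕ) : Prop :=
  ∃ (i : ℕ) (j : ℤ), β' i j + 1 = β i j ∧ β' (i + 1) j + 1 = β (i + 1) j ∧
    ∀ (u : ℕ) (v : ℤ), (u, v) ≠ (i, j) → (u, v) ≠ (i + 1, j) → β' u v = β u v

/-- `β'` is obtained from `β` by a (finite, possibly empty) sequence of consecutive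
cancellations. -/
def ObtainedByCancellations (β β' : ℕ → ℤ → ℕ) : Prop :=
  Relation.ReflTransGen IsConsecutiveCancellation β β'

/-- `(A/𝔞) ⊗_ℤ k`, where `A = ℤ[x₁, …, xₙ]`. -/
def BaseChange {n : ℕ} (a : Ideal (MvPolynomial (Fin n) ℤ)) (k : Type*) [Field k] : Type _ :=
  (MvPolynomial (Fin n) ℤ ⧸ a) ⊗[ℤ] k

instance {n : ℕ} (a : Ideal (MvPolynomial (Fin n) ℤ)) (k : Type*) [Field k] :
    CommRing (BaseChange a k) :=
  inferInstanceAs (CommRing ((MvPolynomial (Fin n) ℤ ⧸ a) ⊗[ℤ] k))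

/-- The canonical ring homomorphism `A/𝔞 → (A/𝔞) ⊗_ℤ k`, `y ↦ y ⊗ 1`. -/
def BaseChange.ofQuotient {n : ℕ} (a : Ideal (MvPolynomial (Fin n) ℤ)) (k : Type*) [Field k] :
    MvPolynomial (Fin n) ℤ ⧸ a →+* BaseChange a k :=
  (Algebra.TensorProduct.includeLeft :
    MvPolynomial (Fin n) ℤ ⧸ a →ₐ[ℤ] (MvPolynomial (Fin n) ℤ ⧸ a) ⊗[ℤ] k).toRingHom

/-- The canonical ring homomorphism `k → (A/𝔞) ⊗_ℤ k`, `c ↦ 1 ⊗ c`. -/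
def BaseChange.ofScalar {n : ℕ} (a : Ideal (MvPolynomial (Fin n) ℤ)) (k : Type*) [Field k] :
    k →+* BaseChange a k :=
  (Algebra.TensorProduct.includeRight : k →ₐ[ℤ] (MvPolynomial (Fin n) ℤ ⧸ a) ⊗[ℤ] k).toRingHom

/-- The canonical ring homomorphism `k[x₁, …, xₙ] = A ⊗_ℤ k → (A/𝔞) ⊗_ℤ k`, which sends
`c ∈ k` to `1 ⊗ c` and `xᵢ` to `xᵢ ⊗ 1`. -/
def toBaseChange {n : ℕ} (a : Ideal (MvPolynomial (Fin n) ℤ)) (k : Type*) [Field k] :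
    MvPolynomial (Fin n) k →+* BaseChange a k :=
  MvPolynomial.eval₂Hom (BaseChange.ofScalar a k)
    (fun i => BaseChange.ofQuotient a k (Ideal.Quotient.mk a (MvPolynomial.X i)))

/-- `(A/𝔞) ⊗_ℤ k` as a module over `k[x₁, …, xₙ] = A ⊗_ℤ k`. -/
instance {n : ℕ} (a : Ideal (MvPolynomial (Fin n) ℤ)) (k : Type*) [Field k] :
    Module (MvPolynomial (Fin n) k) (BaseChange a k) :=
  Module.compHom (R := BaseChange a k) (BaseChange a k) (toBaseChange a k)

/-- The degree `j` part of `(A/𝔞) ⊗_ℤ k`, generated by all `f ⊗ c = (f ⊗ 1)(1 ⊗ c)` with `f`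
the class of a form of degree `j` and `c ∈ k`. -/
def baseChangeDegree {n : ℕ} (a : Ideal (MvPolynomial (Fin n) ℤ)) (k : Type*) [Field k]
    (j : ℤ) : AddSubgroup (BaseChange a k) :=
  AddSubgroup.closure
    {y | ∃ f ∈ polyDegree ℤ n j, ∃ c : k,
      y = BaseChange.ofQuotient a k (Ideal.Quotient.mk a f) * BaseChange.ofScalar a k c}

end BettiCancellation

end

noncomputable section

namespace BettiCancellation

open Module

/-! Graded Betti numbers are dimensions of Koszul homology, and the Koszul complex of the variables
is already defined over `ℤ`. In internal degree `j` the Koszul complex of `A/𝔞` consists of finitely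
generated free abelian groups, because `A/𝔞` is torsion-free. Hence its base changes to `ℚ` and to
`𝔽_p` have chain spaces of the same dimensions, while the rank of a differential can only drop
modulo `p`. Since `dim H_i = dim C_i - rank d_i - rank d_{i+1}`, a drop of `r` in the rank of
`d_{i+1}` in degree `j` raises both `β_{i,j}` and `β_{i+1,j}` by `r` over `𝔽_p`; undoing it is
exactly `r` consecutive cancellations.

Two facts carry the argument. First, `InfiniteResolution.koszulNumber_eq` reads Betti numbers off
Koszul homology. The Koszul complex with coefficients in a free module `F` is acyclic in positive
degrees with `H_0 = F/𝔪F` (`freeDegree_acyclic`, `exists_koszulD_eq_iff_constantCoeff`), and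
minimality puts each kernel inside `𝔪F`, so homology shifts down the resolution one syzygy at a time
(`koszulNumber_shift`, `koszulNumber_zero`). This also yields the syzygy theorem, since there are no
Koszul chains above degree `n`. Second, semicontinuity of rank: integral vectors independent modulo
`p` are independent over `ℚ` (`linearIndependent_rat_of_charP`). It bounds the ranks of the
differentials and one direction of the equality of Hilbert functions; the other direction
(`finrank_rat_le_finrank_charP`) reduces a `ℤ`-basis of each graded piece modulo `p`.

Existence of resolutions comes from iterating covers by minimal systems of homogeneous generators
(`exists_minimal_cover`). -/

/-- The index set of the basis of the Koszul complex on `m` elements. -/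
def KoszulIndex : ℕ → Type
  | 0 => Unit
  | m + 1 => KoszulIndex m ⊕ KoszulIndex m

instance KoszulIndex.fintype : ∀ m, Fintype (KoszulIndex m)
  | 0 => inferInstanceAs (Fintype Unit)
  | m + 1 =>
    letI := KoszulIndex.fintype m
    inferInstanceAs (Fintype (KoszulIndex m ⊕ KoszulIndex m))

/-- The homological degree of a basis element of the Koszul complex. -/
def KoszulIndex.size : ∀ {m : ℕ}, KoszulIndex m → ℕ
  | 0, _ => 0
  | _ + 1, Sum.inl s => KoszulIndex.size s
  | _ + 1, Sum.inr s => KoszulIndex.size s + 1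

/-- The basis element of homological degree zero. -/
def KoszulIndex.empty : ∀ m : ℕ, KoszulIndex m
  | 0 => ()
  | m + 1 => Sum.inl (KoszulIndex.empty m)

theorem KoszulIndex.size_le : ∀ {m : ℕ} (s : KoszulIndex m), s.size ≤ m
  | 0, _ => le_rfl
  | _ + 1, Sum.inl s => (KoszulIndex.size_le s).trans (Nat.le_succ _)
  | _ + 1, Sum.inr s => Nat.succ_le_succ (KoszulIndex.size_le s)

theorem KoszulIndex.size_empty : ∀ m : ℕ, (KoszulIndex.empty m).size = 0
  | 0 => rfl
  | m + 1 => KoszulIndex.size_empty m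

theorem KoszulIndex.eq_empty_of_size : ∀ {m : ℕ} (s : KoszulIndex m), s.size = 0 → s = .empty m
  | 0, _, _ => rfl
  | _ + 1, Sum.inl s, h => congrArg Sum.inl (KoszulIndex.eq_empty_of_size s h)
  | _ + 1, Sum.inr _, h => absurd h (Nat.succ_ne_zero _)

/-! ### The Koszul complex, its graded strands, and a criterion for acyclicity. -/

section Koszul

variable {R M : Type*} [CommRing R] [AddCommGroup M] [Module R M]

/-- The component of a Koszul chain not involving the last basis vector. -/
def KoszulIndex.left {M : Type*} {m : ℕ} (f : KoszulIndex (m + 1) → M) : KoszulIndex m → M :=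
  fun s => f (Sum.inl s)

/-- The component of a Koszul chain involving the last basis vector. -/
def KoszulIndex.right {M : Type*} {m : ℕ} (f : KoszulIndex (m + 1) → M) : KoszulIndex m → M :=
  fun s => f (Sum.inr s)

/-- Assemble a Koszul chain on `m + 1` elements from two chains on `m` elements. -/
def KoszulIndex.glue {M : Type*} {m : ℕ} (f g : KoszulIndex m → M) : KoszulIndex (m + 1) → M :=
  Sum.elim f g

open KoszulIndex

theorem KoszulIndex.ext_succ {M : Type*} {m : ℕ} {f g : KoszulIndex (m + 1) → M}
    (h₁ : left f = left g) (h₂ : right f = right g) : f = g := by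
  funext s
  rcases s with s | s
  · exact congrFun h₁ s
  · exact congrFun h₂ s

@[simp] theorem KoszulIndex.left_glue {M : Type*} {m : ℕ} (f g : KoszulIndex m → M) :
    left (glue f g) = f := rfl

@[simp] theorem KoszulIndex.right_glue {M : Type*} {m : ℕ} (f g : KoszulIndex m → M) :
    right (glue f g) = g := rfl

/-- The differential of the Koszul complex of `u 0, …, u (m - 1)` with coefficients in `M`. -/
def koszulD (M : Type*) [AddCommGroup M] [Module R M] (u : ℕ → R) :
    ∀ m : ℕ, (KoszulIndex m → M) →ₗ[R] (KoszulIndex m → M)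
  | 0 => 0
  | m + 1 =>
    -- The complex on `m + 1` elements is the mapping cone of multiplication by `u m` on the complex
    -- on `m` elements; the sign on the second component makes the differential square to zero.
    { toFun := fun f => glue (koszulD M u m (left f) + u m • right f) (-koszulD M u m (right f))
      map_add' := fun f g => by
        have h₁ : left (f + g) = left f + left g := rfl
        have h₂ : right (f + g) = right f + right g := rfl
        refine ext_succ ?_ ?_
        · change koszulD M u m (left (f + g)) + u m • right (f + g) =
            (koszulD M u m (left f) + u m • right f) + (koszulD M u m (left g) + u m • right g)
          rw [h₁, h₂, map_add, smul_add]; abel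
        · change -koszulD M u m (right (f + g)) =
            -koszulD M u m (right f) + -koszulD M u m (right g)
          rw [h₂, map_add]; abel
      map_smul' := fun c f => by
        have h₁ : left (c • f) = c • left f := rfl
        have h₂ : right (c • f) = c • right f := rfl
        refine ext_succ ?_ ?_
        · change koszulD M u m (left (c • f)) + u m • right (c • f) =
            c • (koszulD M u m (left f) + u m • right f)
          rw [h₁, h₂, map_smul, smul_add, smul_comm]
        · change -koszulD M u m (right (c • f)) = c • -koszulD M u m (right f)
          rw [h₂, map_smul, smul_neg] }

variable {u : ℕ → R} {m : ℕ}

theorem left_koszulD (f : KoszulIndex (m + 1) → M) :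
    left (koszulD M u (m + 1) f) = koszulD M u m (left f) + u m • right f := rfl

theorem right_koszulD (f : KoszulIndex (m + 1) → M) :
    right (koszulD M u (m + 1) f) = -koszulD M u m (right f) := rfl

theorem koszulD_koszulD : ∀ {m : ℕ} (f : KoszulIndex m → M),
    koszulD M u m (koszulD M u m f) = 0
  | 0, _ => rfl
  | m + 1, f => by
    refine ext_succ ?_ ?_
    · rw [left_koszulD, left_koszulD, right_koszulD, map_add, koszulD_koszulD, map_smul]
      simp only [smul_neg, zero_add, add_neg_cancel]; rfl
    · rw [right_koszulD, right_koszulD, map_neg, koszulD_koszulD, neg_neg]; rfl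

/-- Functoriality of the Koszul differential along a semilinear map. -/
theorem koszulD_comp {R' M' : Type*} [CommRing R'] [AddCommGroup M'] [Module R' M']
    {u' : ℕ → R'} (φ : M →+ M') (hφ : ∀ t y, φ (u t • y) = u' t • φ y) :
    ∀ {m : ℕ} (f : KoszulIndex m → M),
      koszulD M' u' m (fun s => φ (f s)) = fun s => φ (koszulD M u m f s)
  | 0, _ => by funext s; exact (map_zero φ).symm
  | m + 1, f => by
    refine ext_succ ?_ ?_
    · rw [left_koszulD]
      change koszulD M' u' m (fun s => φ (left f s)) + _ =
        fun s => φ (koszulD M u m (left f) s + u m • right f s)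
      rw [koszulD_comp φ hφ]
      funext s
      simp only [Pi.add_apply, Pi.smul_apply, map_add, hφ]; rfl
    · rw [right_koszulD]
      change -koszulD M' u' m (fun s => φ (right f s)) = fun s => φ (-koszulD M u m (right f) s)
      rw [koszulD_comp φ hφ]
      funext s
      simp only [Pi.neg_apply, map_neg]

variable {k : Type*} [CommRing k] [Module k M]

/-- The degree `j` part of the module of Koszul `i`-chains with coefficients in a graded module
with graded pieces `W`. -/
def strand (W : ℤ → Submodule k M) (m i : ℕ) (j : ℤ) : Submodule k (KoszulIndex m → M) where
  carrier := {f | ∀ s : KoszulIndex m, (s.size = i → f s ∈ W (j - i)) ∧ (s.size ≠ i → f s = 0)}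
  zero_mem' := fun s => ⟨fun _ => zero_mem _, fun _ => rfl⟩
  add_mem' := fun {f g} hf hg s => ⟨fun h => add_mem ((hf s).1 h) ((hg s).1 h), fun h => by
    rw [Pi.add_apply, (hf s).2 h, (hg s).2 h, add_zero]⟩
  smul_mem' := fun c f hf s => ⟨fun h => Submodule.smul_mem _ c ((hf s).1 h), fun h => by
    rw [Pi.smul_apply, (hf s).2 h, smul_zero]⟩

variable {W : ℤ → Submodule k M} {i : ℕ} {j : ℤ}

theorem strand_eq_bot (h : m < i) : strand W m i j = ⊥ := by
  rw [eq_bot_iff]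
  intro f hf
  rw [Submodule.mem_bot]
  funext s
  exact (hf s).2 (by have := s.size_le; omega)

/-- The new exterior generator has homological degree 1 and internal degree 1, so splitting it off
lowers both `i` and `j` by one and leaves the degree of the coefficients unchanged. -/
theorem mem_strand_succ {f : KoszulIndex (m + 1) → M} :
    f ∈ strand W (m + 1) (i + 1) j ↔
      left f ∈ strand W m (i + 1) j ∧ right f ∈ strand W m i (j - 1) := by
  have e : j - ((i + 1 : ℕ) : ℤ) = j - 1 - i := by push_cast; ring
  constructor
  · intro h
    refine ⟨fun s => h (Sum.inl s), fun s => ⟨fun hs => ?_, fun hs => ?_⟩⟩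
    · rw [← e]; exact (h (Sum.inr s)).1 (congrArg Nat.succ hs)
    · exact (h (Sum.inr s)).2 (fun h' => hs (Nat.succ_injective h'))
  · rintro ⟨h₁, h₂⟩ (s | s)
    · exact h₁ s
    · refine ⟨fun hs => ?_, fun hs => ?_⟩
      · rw [e]; exact (h₂ s).1 (Nat.succ_injective hs)
      · exact (h₂ s).2 (fun h' => hs (congrArg Nat.succ h'))

theorem mem_strand_zero {f : KoszulIndex (m + 1) → M} :
    f ∈ strand W (m + 1) 0 j ↔ left f ∈ strand W m 0 j ∧ right f = 0 := by
  constructor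
  · intro h
    exact ⟨fun s => h (Sum.inl s), funext fun s => (h (Sum.inr s)).2 (Nat.succ_ne_zero _)⟩
  · rintro ⟨h₁, h₂⟩ (s | s)
    · exact h₁ s
    · exact ⟨fun hs => absurd hs (Nat.succ_ne_zero _), fun _ => congrFun h₂ s⟩

theorem koszulD_strand_zero : ∀ {m : ℕ} {f : KoszulIndex m → M}, f ∈ strand W m 0 j →
    koszulD M u m f = 0
  | 0, _, _ => rfl
  | m + 1, f, h => by
    obtain ⟨h₁, h₂⟩ := mem_strand_zero.1 h
    refine ext_succ ?_ ?_
    · rw [left_koszulD, koszulD_strand_zero h₁, h₂, smul_zero, add_zero]; rfl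
    · rw [right_koszulD, h₂, map_zero, neg_zero]; rfl

theorem smul_strand {c : R} (hc : ∀ j y, y ∈ W j → c • y ∈ W (j + 1)) {f : KoszulIndex m → M}
    (hf : f ∈ strand W m i (j - 1)) : c • f ∈ strand W m i j := fun s => by
  refine ⟨fun hs => ?_, fun hs => ?_⟩
  · have := hc _ _ ((hf s).1 hs)
    rwa [show j - 1 - (i : ℤ) + 1 = j - i by ring] at this
  · rw [Pi.smul_apply, (hf s).2 hs, smul_zero]

theorem koszulD_mem_strand (hu : ∀ t j y, y ∈ W j → u t • y ∈ W (j + 1)) :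
    ∀ {m i : ℕ} {j : ℤ} {f : KoszulIndex m → M}, f ∈ strand W m (i + 1) j →
      koszulD M u m f ∈ strand W m i j
  | 0, _, _, _, _ => zero_mem _
  | m + 1, 0, j, f, h => by
    obtain ⟨h₁, h₂⟩ := mem_strand_succ.1 h
    refine mem_strand_zero.2 ⟨?_, ?_⟩
    · rw [left_koszulD]
      exact add_mem (koszulD_mem_strand hu h₁) (smul_strand (hu m) h₂)
    · rw [right_koszulD, koszulD_strand_zero h₂, neg_zero]
  | m + 1, i + 1, j, f, h => by
    obtain ⟨h₁, h₂⟩ := mem_strand_succ.1 h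
    refine mem_strand_succ.2 ⟨?_, ?_⟩
    · rw [left_koszulD]
      exact add_mem (koszulD_mem_strand hu h₁) (smul_strand (hu m) h₂)
    · rw [right_koszulD]
      exact neg_mem (koszulD_mem_strand hu h₂)

/-- A Koszul cycle of positive homological degree is a boundary as soon as each `u t` is
injective on the degree zero homology of the preceding elements. -/
theorem exists_koszulD_eq (hu : ∀ t j y, y ∈ W j → u t • y ∈ W (j + 1)) :
    ∀ {m : ℕ}, (∀ t < m, ∀ (j : ℤ) (f : KoszulIndex t → M), f ∈ strand W t 0 j →
      (∃ g ∈ strand W t 1 (j + 1), koszulD M u t g = u t • f) →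
      ∃ g ∈ strand W t 1 j, koszulD M u t g = f) →
    ∀ {i : ℕ} {j : ℤ} {f : KoszulIndex m → M}, f ∈ strand W m (i + 1) j →
      koszulD M u m f = 0 → ∃ g ∈ strand W m (i + 2) j, koszulD M u m g = f
  | 0, _, i, j, f, hf, _ => by
    rw [strand_eq_bot (Nat.succ_pos i)] at hf
    exact ⟨0, zero_mem _, by rw [map_zero, (Submodule.mem_bot _).1 hf]⟩
  | m + 1, H, i, j, f, hf, hd => by
    have IH := @exists_koszulD_eq hu m (fun t ht => H t (ht.trans (Nat.lt_succ_self m)))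
    obtain ⟨h₁, h₂⟩ := mem_strand_succ.1 hf
    have d₁ : koszulD M u m (left f) + u m • right f = 0 := congrArg left hd
    have d₂ : koszulD M u m (right f) = 0 := neg_eq_zero.1 (congrArg right hd)
    -- The second component is a cycle. In positive degree the induction hypothesis bounds it; in
    -- degree zero, `d₁` shows that `u m` times it is the boundary of `-left f`, so the injectivity
    -- hypothesis applies.
    obtain ⟨b, hb, hdb⟩ : ∃ b ∈ strand W m (i + 1) (j - 1), koszulD M u m b = right f := by
      rcases i with _ | i
      · refine H m (Nat.lt_succ_self m) _ _ h₂ ⟨-left f, ?_, ?_⟩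
        · rw [sub_add_cancel]; exact neg_mem h₁
        · rw [map_neg]; exact neg_eq_of_add_eq_zero_right d₁
      · exact IH h₂ d₂
    -- With `b` bounding the second component, `left f + u m • b` becomes a cycle on the first `m`
    -- elements, in positive degree, hence a boundary.
    obtain ⟨c, hc, hdc⟩ := IH (add_mem h₁ (smul_strand (hu m) hb))
      (by rw [map_add, map_smul, hdb, d₁])
    refine ⟨glue c (-b), mem_strand_succ.2 ⟨hc, neg_mem hb⟩, ext_succ ?_ ?_⟩
    · rw [left_koszulD, left_glue, right_glue, hdc, smul_neg, add_neg_cancel_right]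
    · rw [right_koszulD, right_glue, map_neg, neg_neg, hdb]

end Koszul

/-! ### Acyclicity for graded free coefficients, read off from monomials. -/

section Free

open MvPolynomial KoszulIndex

variable {k : Type*} [CommRing k] {n r : ℕ}

/-- The degree `j` part of the graded free module with basis elements of degrees `b s`. -/
def freeDegree (k : Type*) [CommRing k] (n : ℕ) {r : ℕ} (b : Fin r → ℤ) (j : ℤ) :
    Submodule k (Fin r → MvPolynomial (Fin n) k) where
  carrier := {f | IsHomogeneousOfDegree b j f}
  zero_mem' := fun _ => zero_mem _
  add_mem' := fun hf hg s => add_mem (hf s) (hg s)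
  smul_mem' := fun c _ hf s => Submodule.smul_mem _ c (hf s)

/-- The variables `x₀, x₁, …` of the polynomial ring, continued by zero. -/
def variableSeq (k : Type*) [CommRing k] (n : ℕ) (t : ℕ) : MvPolynomial (Fin n) k :=
  if h : t < n then X ⟨t, h⟩ else 0

theorem variableSeq_of_lt {t : ℕ} (h : t < n) : variableSeq k n t = X ⟨t, h⟩ := dif_pos h

theorem variableSeq_mem (t : ℕ) : variableSeq k n t ∈ polyDegree k n 1 := by
  unfold variableSeq
  split_ifs with h
  · exact isWeightedHomogeneous_X k (fun _ : Fin n => (1 : ℤ)) ⟨t, h⟩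
  · exact zero_mem _

theorem mul_mem_polyDegree {i j : ℤ} {f g : MvPolynomial (Fin n) k} (hf : f ∈ polyDegree k n i)
    (hg : g ∈ polyDegree k n j) : f * g ∈ polyDegree k n (i + j) :=
  IsWeightedHomogeneous.mul hf hg

theorem smul_mem_freeDegree {b : Fin r → ℤ} {i j : ℤ} {c : MvPolynomial (Fin n) k}
    {f : Fin r → MvPolynomial (Fin n) k} (hc : c ∈ polyDegree k n i) (hf : f ∈ freeDegree k n b j) :
    c • f ∈ freeDegree k n b (i + j) := fun s => by
  have := mul_mem_polyDegree hc (hf s)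
  rwa [← add_sub_assoc] at this

theorem variableSeq_smul_mem_freeDegree {b : Fin r → ℤ} (t : ℕ) (j : ℤ)
    (f : Fin r → MvPolynomial (Fin n) k) (hf : f ∈ freeDegree k n b j) :
    variableSeq k n t • f ∈ freeDegree k n b (j + 1) := by
  rw [add_comm]; exact smul_mem_freeDegree (variableSeq_mem t) hf

/-- The Koszul chain of homological degree zero given by an element. -/
def zeroChain {M : Type*} [Zero M] (m : ℕ) (y : M) : KoszulIndex m → M :=
  fun s => if s.size = 0 then y else 0

theorem zeroChain_empty {M : Type*} [Zero M] (m : ℕ) (y : M) : zeroChain m y (.empty m) = y :=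
  if_pos (size_empty m)

theorem zeroChain_mem_strand {M : Type*} [AddCommGroup M] [Module k M] {W : ℤ → Submodule k M}
    {j : ℤ} (m : ℕ) {y : M} (hy : y ∈ W j) : zeroChain m y ∈ strand W m 0 j := fun s => by
  refine ⟨fun hs => ?_, fun hs => if_neg hs⟩
  rw [zeroChain, if_pos hs, Nat.cast_zero, sub_zero]; exact hy

theorem eq_zeroChain {M : Type*} [AddCommGroup M] [Module k M] {W : ℤ → Submodule k M} {j : ℤ}
    {m : ℕ} {f : KoszulIndex m → M} (hf : f ∈ strand W m 0 j) : f = zeroChain m (f (.empty m)) := by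
  funext s
  by_cases hs : s.size = 0
  · rw [eq_empty_of_size s hs, zeroChain_empty]
  · rw [(hf s).2 hs, zeroChain, if_neg hs]

theorem empty_mem_of_mem_strand {M : Type*} [AddCommGroup M] [Module k M] {W : ℤ → Submodule k M}
    {j : ℤ} {m : ℕ} {f : KoszulIndex m → M} (hf : f ∈ strand W m 0 j) : f (.empty m) ∈ W j := by
  have := (hf (.empty m)).1 (size_empty m)
  rwa [Nat.cast_zero, sub_zero] at this

theorem divMonomial_mem_polyDegree {j : ℤ} {f : MvPolynomial (Fin n) k} (hf : f ∈ polyDegree k n j)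
    (s : Fin n) : f.divMonomial (Finsupp.single s 1) ∈ polyDegree k n (j - 1) := by
  intro d hd
  rw [coeff_divMonomial] at hd
  have := hf hd
  rw [map_add, Finsupp.weight_single] at this
  rw [one_smul] at this
  omega

/-- A chain of degree zero with coefficients in a free module is a boundary of the Koszul complex
on the first `t` variables iff each of its monomials contains one of these variables. -/
theorem exists_koszulD_eq_iff {b : Fin r → ℤ} : ∀ {t : ℕ}, t ≤ n → ∀ {j : ℤ}
    {f : KoszulIndex t → Fin r → MvPolynomial (Fin n) k},
    f ∈ strand (freeDegree k n b) t 0 j →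
    ((∃ g ∈ strand (freeDegree k n b) t 1 j, koszulD _ (variableSeq k n) t g = f) ↔
      ∀ l d, coeff d (f (.empty t) l) ≠ 0 → ∃ s : Fin n, (s : ℕ) < t ∧ d s ≠ 0)
  | 0, _, j, f, hf => by
    constructor
    · rintro ⟨g, -, rfl⟩ l d h
      exact absurd (coeff_zero d) h
    · intro h
      refine ⟨0, zero_mem _, ?_⟩
      rw [map_zero, eq_zeroChain hf]
      have : f (.empty 0) = 0 := by
        funext l
        ext d
        by_contra hd
        obtain ⟨s, hs, -⟩ := h l d hd
        exact absurd hs (Nat.not_lt_zero _)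
      rw [this]
      funext s
      simp [zeroChain]
  | t + 1, ht, j, f, hf => by
    have ht' : t < n := ht
    obtain ⟨h₁, h₂⟩ := mem_strand_zero.1 hf
    constructor
    · rintro ⟨g, hg, rfl⟩ l d hd
      obtain ⟨g₁, g₂⟩ := mem_strand_succ.1 hg
      have hl : koszulD _ (variableSeq k n) (t + 1) g (.empty (t + 1)) l =
          koszulD _ (variableSeq k n) t (left g) (.empty t) l +
            X ⟨t, ht'⟩ * right g (.empty t) l := by
        rw [← variableSeq_of_lt ht']; rfl
      rw [hl, coeff_add] at hd
      by_cases h0 : coeff d (koszulD _ (variableSeq k n) t (left g) (.empty t) l) = 0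
      · rw [h0, zero_add, coeff_X_mul'] at hd
        refine ⟨⟨t, ht'⟩, Nat.lt_succ_self t, ?_⟩
        by_contra hc
        rw [if_neg (by rwa [Finsupp.notMem_support_iff])] at hd
        exact hd rfl
      · obtain ⟨s, hs, hs'⟩ := (exists_koszulD_eq_iff ht'.le
          (koszulD_mem_strand variableSeq_smul_mem_freeDegree g₁)).1 ⟨_, g₁, rfl⟩ l d h0
        exact ⟨s, hs.trans (Nat.lt_succ_self t), hs'⟩
    · intro h
      -- Division with remainder by the variable `x_t`: the quotient `y` is the component along the
      -- new generator, and the remainder has no monomial containing `x_t`, so it is handled by the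
      -- induction.
      set y : Fin r → MvPolynomial (Fin n) k :=
        fun l => (left f (.empty t) l).divMonomial (Finsupp.single ⟨t, ht'⟩ 1) with hy
      have hyW : y ∈ freeDegree k n b (j - 1) := fun l => by
        have := divMonomial_mem_polyDegree (empty_mem_of_mem_strand h₁ l) ⟨t, ht'⟩
        rwa [sub_right_comm] at this
      have hyS := zeroChain_mem_strand t hyW
      obtain ⟨g, hg, hgd⟩ := (exists_koszulD_eq_iff ht'.le (sub_mem h₁
        (smul_strand (variableSeq_smul_mem_freeDegree t) hyS))).2 (fun l d hd => by
          have e : (left f - variableSeq k n t • zeroChain t y) (.empty t) l =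
              (left f (.empty t) l).modMonomial (Finsupp.single ⟨t, ht'⟩ 1) := by
            rw [Pi.sub_apply, Pi.smul_apply, zeroChain_empty, Pi.sub_apply, Pi.smul_apply,
              variableSeq_of_lt ht', smul_eq_mul, sub_eq_iff_eq_add]
            exact (modMonomial_add_divMonomial_single _ _).symm
          rw [e] at hd
          have hle : ¬ Finsupp.single (⟨t, ht'⟩ : Fin n) 1 ≤ d := fun hle =>
            hd (coeff_modMonomial_of_le _ hle)
          rw [coeff_modMonomial_of_not_le _ hle] at hd
          obtain ⟨s, hs, hs'⟩ := h l d hd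
          refine ⟨s, lt_of_le_of_ne (Nat.le_of_lt_succ hs) ?_, hs'⟩
          rintro rfl
          exact hle (Finsupp.single_le_iff.2 (Nat.one_le_iff_ne_zero.2 hs')))
      refine ⟨glue g (zeroChain t y), mem_strand_succ.2 ⟨hg, hyS⟩, ext_succ ?_ ?_⟩
      · rw [left_koszulD, left_glue, right_glue, hgd, sub_add_cancel]
      · rw [right_koszulD, right_glue, koszulD_strand_zero hyS, neg_zero, h₂]

/-- The Koszul complex on the variables with coefficients in a graded free module is acyclic in
positive homological degrees. -/
theorem freeDegree_acyclic {b : Fin r → ℤ} {i : ℕ} {j : ℤ}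
    {f : KoszulIndex n → Fin r → MvPolynomial (Fin n) k}
    (hf : f ∈ strand (freeDegree k n b) n (i + 1) j)
    (hd : koszulD _ (variableSeq k n) n f = 0) :
    ∃ g ∈ strand (freeDegree k n b) n (i + 2) j, koszulD _ (variableSeq k n) n g = f := by
  refine exists_koszulD_eq variableSeq_smul_mem_freeDegree (fun t ht j f hf h => ?_) hf hd
  have hX : variableSeq k n t • f ∈ strand (freeDegree k n b) t 0 (j + 1) :=
    smul_strand (variableSeq_smul_mem_freeDegree t) (by rwa [add_sub_cancel_right])
  refine (exists_koszulD_eq_iff ht.le hf).2 fun l d hd => ?_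
  -- Each monomial `d` of `f` gives the monomial `x_t d` of `x_t f`. The latter contains some `x_s`
  -- with `s < t`, and as `s ≠ t` that variable already occurs in `d`.
  obtain ⟨s, hs, hs'⟩ := (exists_koszulD_eq_iff ht.le hX).1 h l (Finsupp.single ⟨t, ht⟩ 1 + d) (by
    rw [Pi.smul_apply, Pi.smul_apply, variableSeq_of_lt ht, smul_eq_mul, coeff_X_mul]; exact hd)
  refine ⟨s, hs, ?_⟩
  have hne : (⟨t, ht⟩ : Fin n) ≠ s := fun h => by rw [← h] at hs; exact lt_irrefl _ hs
  rwa [Finsupp.add_apply, Finsupp.single_eq_of_ne' hne, zero_add] at hs'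

/-- Once all variables are used, every monomial other than 1 contains one of them; thus the zeroth
homology is `F/𝔪F`. -/
theorem exists_koszulD_eq_iff_constantCoeff {b : Fin r → ℤ} {j : ℤ}
    {f : KoszulIndex n → Fin r → MvPolynomial (Fin n) k}
    (hf : f ∈ strand (freeDegree k n b) n 0 j) :
    (∃ g ∈ strand (freeDegree k n b) n 1 j, koszulD _ (variableSeq k n) n g = f) ↔
      ∀ l, constantCoeff (f (.empty n) l) = 0 := by
  rw [exists_koszulD_eq_iff le_rfl hf]
  refine forall_congr' fun l => ⟨fun h => ?_, fun h d hd => ?_⟩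
  · by_contra h0
    obtain ⟨s, -, hs⟩ := h 0 h0
    exact hs rfl
  · have : d ≠ 0 := by rintro rfl; exact hd h
    obtain ⟨s, hs⟩ := Finsupp.ne_iff.1 this
    exact ⟨s, s.2, hs⟩

end Free

/-! ### Dimension counts replacing the long exact homology sequence. -/

section LinearAlgebra

variable {k V V' : Type*} [Field k] [AddCommGroup V] [Module k V] [AddCommGroup V'] [Module k V']

/-- Rank–nullity for the restriction to `P`, phrased inside the ambient space, so that homology
dimensions can be compared without forming quotients. -/
theorem finrank_map_add_finrank_inf_ker (P : Submodule k V) [FiniteDimensional k P]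
    (g : V →ₗ[k] V') : finrank k (P.map g) + finrank k ↥(P ⊓ LinearMap.ker g) = finrank k P := by
  have h := LinearMap.finrank_range_add_finrank_ker (g.domRestrict P)
  rw [LinearMap.range_domRestrict, LinearMap.ker_domRestrict] at h
  rw [← h, ← Submodule.map_comap_subtype,
    (Submodule.equivMapOfInjective P.subtype P.injective_subtype _).finrank_eq]

/-- Dimension shifting for one step of the long exact homology sequence. -/
theorem finrank_homology_shift {T₀ T₁ T₂ : Submodule k V} [FiniteDimensional k T₀]
    [FiniteDimensional k T₁] [FiniteDimensional k T₂] {D : V →ₗ[k] V} {D' : V' →ₗ[k] V'}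
    {Φ : V →ₗ[k] V'} (hΦ : ∀ v, Φ (D v) = D' (Φ v)) (hD : ∀ v, D (D v) = 0)
    (h₁ : T₁.map D ≤ T₀) (h₂ : T₂.map D ≤ T₁) (ex₁ : T₁ ⊓ LinearMap.ker D ≤ T₂.map D)
    (ex₀ : T₀ ⊓ LinearMap.ker Φ ⊓ LinearMap.ker D ≤ T₁.map D) :
    (finrank k ↥(T₁.map Φ ⊓ LinearMap.ker D') : ℤ) - finrank k ((T₂.map Φ).map D') =
      finrank k ↥(T₀ ⊓ LinearMap.ker Φ ⊓ LinearMap.ker D) -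
        finrank k ((T₁ ⊓ LinearMap.ker Φ).map D) := by
  have fin : ∀ {A B : Submodule k V}, FiniteDimensional k A → FiniteDimensional k ↥(A ⊓ B) :=
    fun {A B} _ => Submodule.finiteDimensional_inf_left A B
  have hcomm : D'.comp Φ = Φ.comp D := LinearMap.ext fun v => (hΦ v).symm
  -- `P` consists of the chains that become cycles after `Φ`. Its dimension is computed twice: `Φ`
  -- maps it onto the cycles of the image with kernel `N₁`, while `D`, which realises the connecting
  -- map, sends it onto the cycles of the kernel of `Φ`, with kernel `Z₁`.
  set P := T₁ ⊓ LinearMap.ker (D'.comp Φ) with hP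
  have : FiniteDimensional k P := fin inferInstance
  set N₁ := T₁ ⊓ LinearMap.ker Φ with hN₁
  have : FiniteDimensional k N₁ := fin inferInstance
  set Z₁ := T₁ ⊓ LinearMap.ker D with hZ₁
  have : FiniteDimensional k Z₁ := fin inferInstance
  have e₁ : T₁.map Φ ⊓ LinearMap.ker D' = P.map Φ := by
    apply le_antisymm
    · rintro _ ⟨⟨v, hv, rfl⟩, hv'⟩
      exact ⟨v, ⟨hv, hv'⟩, rfl⟩
    · rintro _ ⟨v, ⟨hv, hv'⟩, rfl⟩
      exact ⟨⟨v, hv, rfl⟩, hv'⟩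
  have e₂ : P ⊓ LinearMap.ker Φ = N₁ := by
    have hle : LinearMap.ker Φ ≤ LinearMap.ker (D'.comp Φ) := fun v hv => by
      rw [LinearMap.mem_ker, LinearMap.comp_apply, LinearMap.mem_ker.1 hv, map_zero]
    rw [hP, inf_assoc, inf_eq_right.2 hle]
  have e₃ : P ⊓ LinearMap.ker D = Z₁ := by
    have hle : LinearMap.ker D ≤ LinearMap.ker (D'.comp Φ) := fun v hv => by
      rw [LinearMap.mem_ker, LinearMap.comp_apply, ← hΦ, LinearMap.mem_ker.1 hv, map_zero]
    rw [hP, inf_assoc, inf_eq_right.2 hle]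
  have e₄ : P.map D = T₀ ⊓ LinearMap.ker Φ ⊓ LinearMap.ker D := by
    apply le_antisymm
    · rintro _ ⟨v, ⟨hv, hv'⟩, rfl⟩
      refine ⟨⟨h₁ ⟨v, hv, rfl⟩, ?_⟩, hD v⟩
      rw [SetLike.mem_coe, LinearMap.mem_ker, hΦ]; exact hv'
    · intro w hw
      obtain ⟨v, hv, rfl⟩ := ex₀ hw
      refine ⟨v, ⟨hv, ?_⟩, rfl⟩
      rw [SetLike.mem_coe, LinearMap.mem_ker, LinearMap.comp_apply, ← hΦ]; exact hw.1.2
  have e₅ : (T₂.map Φ).map D' = Z₁.map Φ := by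
    rw [← Submodule.map_comp, hcomm, Submodule.map_comp]
    congr 1
    refine le_antisymm (le_inf h₂ ?_) ex₁
    rintro _ ⟨v, -, rfl⟩
    exact hD v
  have e₆ : Z₁ ⊓ LinearMap.ker Φ = N₁ ⊓ LinearMap.ker D := by
    rw [hZ₁, hN₁, inf_right_comm]
  have f₁ := finrank_map_add_finrank_inf_ker P Φ
  have f₂ := finrank_map_add_finrank_inf_ker P D
  have f₃ := finrank_map_add_finrank_inf_ker N₁ D
  have f₄ := finrank_map_add_finrank_inf_ker Z₁ Φ
  rw [e₂] at f₁
  rw [e₃, e₄] at f₂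
  rw [e₆] at f₄
  rw [e₁, e₅]
  omega

/-- Zero-chains are all cycles, and those killed by `Φ` are already boundaries, so passing to the
image leaves the zeroth homology unchanged. -/
theorem finrank_homology_zero {T₀ T₁ : Submodule k V} [FiniteDimensional k T₀]
    [FiniteDimensional k T₁] {D : V →ₗ[k] V} {D' : V' →ₗ[k] V'}
    {Φ : V →ₗ[k] V'} (hΦ : ∀ v, Φ (D v) = D' (Φ v)) (hD : T₀ ≤ LinearMap.ker D)
    (h₁ : T₁.map D ≤ T₀) (ex₀ : T₀ ⊓ LinearMap.ker Φ ≤ T₁.map D) :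
    (finrank k ↥(T₀.map Φ ⊓ LinearMap.ker D') : ℤ) - finrank k ((T₁.map Φ).map D') =
      finrank k T₀ - finrank k (T₁.map D) := by
  have hcomm : D'.comp Φ = Φ.comp D := LinearMap.ext fun v => (hΦ v).symm
  have e₁ : T₀.map Φ ⊓ LinearMap.ker D' = T₀.map Φ := by
    rw [inf_eq_left]
    rintro _ ⟨v, hv, rfl⟩
    rw [LinearMap.mem_ker, ← hΦ, LinearMap.mem_ker.1 (hD hv), map_zero]
  have e₂ : (T₁.map Φ).map D' = (T₁.map D).map Φ := by
    rw [← Submodule.map_comp, hcomm, Submodule.map_comp]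
  have e₃ : T₁.map D ⊓ LinearMap.ker Φ = T₀ ⊓ LinearMap.ker Φ :=
    le_antisymm (inf_le_inf_right _ h₁) (le_inf ex₀ inf_le_right)
  have f₁ := finrank_map_add_finrank_inf_ker T₀ Φ
  have f₂ := finrank_map_add_finrank_inf_ker (T₁.map D) Φ
  rw [e₃] at f₂
  rw [e₁, e₂]
  omega

end LinearAlgebra

/-! ### Strands as finite products of graded pieces. -/

section Strand

open KoszulIndex

variable {k M : Type*} [CommRing k] [AddCommGroup M] [Module k M]

/-- A strand of the Koszul complex is a finite product of graded pieces. -/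
def strandEquiv (W : ℤ → Submodule k M) (m i : ℕ) (j : ℤ) :
    strand W m i j ≃ₗ[k] ({s : KoszulIndex m // s.size = i} → W (j - i)) where
  toFun f s := ⟨f.1 s.1, (f.2 s.1).1 s.2⟩
  map_add' _ _ := rfl
  map_smul' _ _ := rfl
  invFun g := ⟨fun s => if h : s.size = i then g ⟨s, h⟩ else 0, fun s =>
    ⟨fun h => by
      change (if h : s.size = i then (g ⟨s, h⟩ : M) else 0) ∈ _
      rw [dif_pos h]; exact (g ⟨s, h⟩).2, fun h => dif_neg h⟩⟩
  left_inv f := by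
    ext s
    by_cases h : s.size = i
    · exact dif_pos h
    · exact (dif_neg h).trans ((f.2 s).2 h).symm
  right_inv g := by
    ext ⟨s, h⟩
    exact dif_pos h

end Strand

/-! ### Koszul homology numbers of a graded module. -/

section Homology

open MvPolynomial KoszulIndex

variable {k : Type*} [Field k] {n : ℕ} {M : Type*} [AddCommGroup M] [Module k M]
  [Module (MvPolynomial (Fin n) k) M] [IsScalarTower k (MvPolynomial (Fin n) k) M]

instance strand_finite (W : ℤ → Submodule k M) [∀ j, FiniteDimensional k (W j)] (m i : ℕ)
    (j : ℤ) : FiniteDimensional k (strand W m i j) :=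
  Module.Finite.equiv (strandEquiv W m i j).symm

/-- Chain dimensions depend only on the Hilbert function of the module. -/
theorem finrank_strand (W : ℤ → Submodule k M) [∀ j, FiniteDimensional k (W j)] (m i : ℕ)
    (j : ℤ) : finrank k (strand W m i j) =
      Fintype.card {s : KoszulIndex m // s.size = i} * finrank k (W (j - i)) := by
  rw [(strandEquiv W m i j).finrank_eq, Module.finrank_pi_fintype, Finset.sum_const, smul_eq_mul,
    Finset.card_univ]

variable (k n M) in
/-- The differential of the Koszul complex on all variables. -/
def koszulMap : (KoszulIndex n → M) →ₗ[k] (KoszulIndex n → M) :=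
  (koszulD M (variableSeq k n) n).restrictScalars k

variable (n) in
/-- The dimension of the degree `j` part of the `i`-th Koszul homology of a graded module with
graded pieces `W`. -/
def koszulNumber (W : ℤ → Submodule k M) (i : ℕ) (j : ℤ) : ℤ :=
  finrank k ↥(strand W n i j ⊓ LinearMap.ker (koszulMap k n M)) -
    finrank k ((strand W n (i + 1) j).map (koszulMap k n M))

/-- A linear map applied to all coefficients of a Koszul chain. -/
def chainMap {M' : Type*} [AddCommGroup M'] [Module k M'] (m : ℕ) (φ : M →ₗ[k] M') :
    (KoszulIndex m → M) →ₗ[k] (KoszulIndex m → M') :=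
  φ.compLeft (KoszulIndex m)

theorem strand_map {M' : Type*} [AddCommGroup M'] [Module k M'] (φ : M →ₗ[k] M')
    (W : ℤ → Submodule k M) (m i : ℕ) (j : ℤ) :
    strand (fun j => (W j).map φ) m i j = (strand W m i j).map (chainMap m φ) := by
  apply le_antisymm
  · intro f hf
    have : ∀ s : KoszulIndex m, ∃ y, (s.size = i → y ∈ W (j - i)) ∧ (s.size ≠ i → y = 0) ∧
        φ y = f s := fun s => by
      by_cases hs : s.size = i
      · obtain ⟨y, hy, e⟩ := (hf s).1 hs
        exact ⟨y, fun _ => hy, fun h => absurd hs h, e⟩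
      · exact ⟨0, fun h => absurd h hs, fun _ => rfl, by rw [map_zero, (hf s).2 hs]⟩
    choose g hg₁ hg₂ hg₃ using this
    exact ⟨g, fun s => ⟨hg₁ s, hg₂ s⟩, funext hg₃⟩
  · rintro _ ⟨g, hg, rfl⟩ s
    refine ⟨fun hs => ⟨g s, (hg s).1 hs, rfl⟩, fun hs => ?_⟩
    change φ (g s) = 0
    rw [(hg s).2 hs, map_zero]

theorem strand_inf_ker {M' : Type*} [AddCommGroup M'] [Module k M'] (φ : M →ₗ[k] M')
    (W : ℤ → Submodule k M) (m i : ℕ) (j : ℤ) :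
    strand (fun j => W j ⊓ LinearMap.ker φ) m i j =
      strand W m i j ⊓ LinearMap.ker (chainMap m φ) := by
  ext f
  constructor
  · intro hf
    refine ⟨fun s => ⟨fun hs => ((hf s).1 hs).1, (hf s).2⟩, funext fun s => ?_⟩
    change φ (f s) = 0
    by_cases hs : s.size = i
    · exact ((hf s).1 hs).2
    · rw [(hf s).2 hs, map_zero]
  · rintro ⟨hf, hf'⟩ s
    exact ⟨fun hs => ⟨(hf s).1 hs, congrFun hf' s⟩, (hf s).2⟩

theorem chainMap_koszulMap {M' : Type*} [AddCommGroup M'] [Module k M']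
    [Module (MvPolynomial (Fin n) k) M'] [IsScalarTower k (MvPolynomial (Fin n) k) M']
    (φ : M →ₗ[MvPolynomial (Fin n) k] M') (f : KoszulIndex n → M) :
    chainMap n (φ.restrictScalars k) (koszulMap k n M f) =
      koszulMap k n M' (chainMap n (φ.restrictScalars k) f) :=
  (koszulD_comp (u := variableSeq k n) (u' := variableSeq k n) φ.toAddMonoidHom
    (fun _ _ => φ.map_smul _ _) f).symm

end Homology

/-! ### Koszul homology of graded free modules and dimension shifting. -/

section Free

open MvPolynomial KoszulIndex

variable {k : Type*} [Field k] {n r : ℕ}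

theorem weight_one_eq_degree {n : ℕ} (d : Fin n →₀ ℕ) :
    Finsupp.weight (fun _ : Fin n => (1 : ℤ)) d = d.degree := by
  rw [Finsupp.weight_apply, Finsupp.degree_apply, Finsupp.sum]; simp

theorem finite_weight_eq (n : ℕ) (j : ℤ) :
    {d : Fin n →₀ ℕ | Finsupp.weight (fun _ : Fin n => (1 : ℤ)) d = j}.Finite := by
  refine (Finsupp.finite_of_degree_le j.toNat).subset fun d hd => ?_
  have := weight_one_eq_degree d
  change Finsupp.weight _ d = j at hd
  change d.degree ≤ j.toNat
  omega

theorem polyDegree_fg (k : Type*) [CommRing k] (n : ℕ) (j : ℤ) : (polyDegree k n j).FG := by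
  classical
  refine ⟨(finite_weight_eq n j).toFinset.image fun d => monomial d 1, le_antisymm ?_ ?_⟩
  · rw [Submodule.span_le]
    intro f hf
    rw [Finset.coe_image] at hf
    obtain ⟨d, hd, rfl⟩ := hf
    rw [Finset.mem_coe, Set.Finite.mem_toFinset] at hd
    exact isWeightedHomogeneous_monomial _ _ _ hd
  · intro f hf
    rw [f.as_sum]
    refine sum_mem fun d hd => ?_
    have : monomial d (coeff d f) = coeff d f • monomial d (1 : k) := by
      rw [smul_monomial, smul_eq_mul, mul_one]
    rw [this]
    refine Submodule.smul_mem _ _ (Submodule.subset_span ?_)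
    rw [Finset.coe_image]
    exact ⟨d, (Set.Finite.mem_toFinset _).2 (hf (mem_support_iff.1 hd)), rfl⟩

instance freeDegree_finite (b : Fin r → ℤ) (j : ℤ) :
    FiniteDimensional k (freeDegree k n b j) := by
  have : ∀ s, FiniteDimensional k (polyDegree k n (j - b s)) := fun s =>
    Module.Finite.iff_fg.2 (polyDegree_fg k n _)
  let e : freeDegree k n b j →ₗ[k] ∀ s, polyDegree k n (j - b s) :=
    { toFun := fun f s => ⟨f.1 s, f.2 s⟩
      map_add' := fun _ _ => rfl
      map_smul' := fun _ _ => rfl }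
  refine FiniteDimensional.of_injective e fun f g h => ?_
  ext1
  funext s
  exact congrArg Subtype.val (congrFun h s)

/-- The map `c` records the constant coefficients at the basis vectors of degree `j`. It is onto,
and its kernel on zero-chains is the space of boundaries, because the other constant coefficients
vanish for degree reasons. -/
theorem finrank_freeDegree_homology (b : Fin r → ℤ) (j : ℤ) :
    (finrank k (strand (freeDegree k n b) n 0 j) : ℤ) -
      finrank k ((strand (freeDegree k n b) n 1 j).map (koszulMap k n _)) =
      Fintype.card {s : Fin r // b s = j} := by
  let c : (KoszulIndex n → Fin r → MvPolynomial (Fin n) k) →ₗ[k] ({s : Fin r // b s = j} → k) :=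
    { toFun := fun f s => coeff 0 (f (.empty n) s)
      map_add' := fun _ _ => rfl
      map_smul' := fun _ _ => rfl }
  have hker : strand (freeDegree k n b) n 0 j ⊓ LinearMap.ker c =
      (strand (freeDegree k n b) n 1 j).map (koszulMap k n _) := by
    ext f
    constructor
    · rintro ⟨hf, hc⟩
      refine (exists_koszulD_eq_iff_constantCoeff hf).2 fun l => ?_
      by_cases hl : b l = j
      · exact congrFun hc ⟨l, hl⟩
      · refine (empty_mem_of_mem_strand hf l).coeff_eq_zero 0 ?_
        rw [map_zero]
        exact fun h => hl (sub_eq_zero.1 h.symm).symm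
    · rintro ⟨g, hg, rfl⟩
      have hf := koszulD_mem_strand variableSeq_smul_mem_freeDegree hg
      refine ⟨hf, funext fun l => ?_⟩
      exact (exists_koszulD_eq_iff_constantCoeff hf).1 ⟨g, hg, rfl⟩ l
  have hsurj : (strand (freeDegree k n b) n 0 j).map c = ⊤ := by
    rw [eq_top_iff]
    intro g _
    refine ⟨zeroChain n fun s => if h : b s = j then C (g ⟨s, h⟩) else 0,
      zeroChain_mem_strand n fun s => ?_, funext fun s => ?_⟩
    · split_ifs with h
      · rw [h, sub_self]; exact isWeightedHomogeneous_C _ _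
      · exact zero_mem _
    · change coeff 0 (zeroChain n (M := Fin r → MvPolynomial (Fin n) k) _ (.empty n) s.1) = g s
      rw [zeroChain_empty, dif_pos s.2, coeff_zero_C]
  have h := finrank_map_add_finrank_inf_ker (strand (freeDegree k n b) n 0 j) c
  rw [hker, hsurj, finrank_top, Module.finrank_fintype_fun_eq_card] at h
  omega

variable {M : Type*} [AddCommGroup M] [Module k M]
  [Module (MvPolynomial (Fin n) k) M] [IsScalarTower k (MvPolynomial (Fin n) k) M]

/-- This is the connecting isomorphism for `0 → ker φ → F → φ(F) → 0`. Acyclicity of `F` gives it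
for positive `i`; for `i = 0` one also needs `H_0(ker φ) → H_0(F)` to vanish, which is what `ker φ ⊆
𝔪F` provides. -/
theorem koszulNumber_shift {b : Fin r → ℤ}
    (φ : (Fin r → MvPolynomial (Fin n) k) →ₗ[MvPolynomial (Fin n) k] M)
    (hφ : ∀ f, φ f = 0 → ∀ l, constantCoeff (f l) = 0) (i : ℕ) (j : ℤ) :
    koszulNumber n (fun j => (freeDegree k n b j).map (φ.restrictScalars k)) (i + 1) j =
      koszulNumber n (fun j => freeDegree k n b j ⊓ LinearMap.ker (φ.restrictScalars k)) i j := by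
  unfold koszulNumber
  rw [strand_map, strand_map, strand_inf_ker, strand_inf_ker]
  refine finrank_homology_shift (T₀ := strand (freeDegree k n b) n i j)
    (chainMap_koszulMap φ) koszulD_koszulD ?_ ?_ ?_ ?_
  · rintro _ ⟨f, hf, rfl⟩
    exact koszulD_mem_strand variableSeq_smul_mem_freeDegree hf
  · rintro _ ⟨f, hf, rfl⟩
    exact koszulD_mem_strand variableSeq_smul_mem_freeDegree hf
  · rintro f ⟨hf, hd⟩
    exact freeDegree_acyclic hf hd
  · rintro f ⟨⟨hf, hf'⟩, hd⟩
    rcases i with _ | i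
    · exact (exists_koszulD_eq_iff_constantCoeff hf).2 (hφ _ (congrFun hf' _))
    · exact freeDegree_acyclic hf hd

theorem koszulNumber_zero {b : Fin r → ℤ}
    (φ : (Fin r → MvPolynomial (Fin n) k) →ₗ[MvPolynomial (Fin n) k] M)
    (hφ : ∀ f, φ f = 0 → ∀ l, constantCoeff (f l) = 0) (j : ℤ) :
    koszulNumber n (fun j => (freeDegree k n b j).map (φ.restrictScalars k)) 0 j =
      Fintype.card {s : Fin r // b s = j} := by
  rw [← finrank_freeDegree_homology (k := k) (n := n)]
  unfold koszulNumber
  rw [strand_map, strand_map]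
  refine finrank_homology_zero (chainMap_koszulMap φ) ?_ ?_ ?_
  · intro f hf
    exact koszulD_strand_zero hf
  · rintro _ ⟨f, hf, rfl⟩
    exact koszulD_mem_strand variableSeq_smul_mem_freeDegree hf
  · rintro f ⟨hf, hf'⟩
    exact (exists_koszulD_eq_iff_constantCoeff hf).2 (hφ _ (congrFun hf' _))

end Free

/-! ### Homogeneous components and the irrelevant ideal. -/

section Components

open MvPolynomial

variable {k : Type*} [Field k] {n r : ℕ}

/-- The degree `j` component of an element of a graded free module. -/
def freeComponent (k : Type*) [Field k] (n : ℕ) {r : ℕ} (b : Fin r → ℤ) (j : ℤ) :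
    (Fin r → MvPolynomial (Fin n) k) →ₗ[k] (Fin r → MvPolynomial (Fin n) k) :=
  LinearMap.pi fun s =>
    (weightedHomogeneousComponent (fun _ : Fin n => (1 : ℤ)) (j - b s)).comp (LinearMap.proj s)

theorem freeComponent_apply (b : Fin r → ℤ) (j : ℤ) (f : Fin r → MvPolynomial (Fin n) k)
    (s : Fin r) : freeComponent k n b j f s =
      weightedHomogeneousComponent (fun _ : Fin n => (1 : ℤ)) (j - b s) (f s) := rfl

theorem freeComponent_mem (b : Fin r → ℤ) (j : ℤ) (f : Fin r → MvPolynomial (Fin n) k) :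
    freeComponent k n b j f ∈ freeDegree k n b j := fun _ =>
  weightedHomogeneousComponent_mem _ _ _

/-- Allowing every larger index set lets a prescribed degree be adjoined to the sum later. -/
theorem exists_sum_freeComponent (b : Fin r → ℤ) (f : Fin r → MvPolynomial (Fin n) k) :
    ∃ S : Finset ℤ, ∀ S', S ⊆ S' → ∑ j ∈ S', freeComponent k n b j f = f := by
  classical
  refine ⟨Finset.univ.biUnion fun s => (f s).support.image fun d =>
    Finsupp.weight (fun _ : Fin n => (1 : ℤ)) d + b s, fun S' hS => ?_⟩
  funext s
  ext d
  rw [Finset.sum_apply, coeff_sum]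
  simp only [freeComponent_apply, coeff_weightedHomogeneousComponent, eq_sub_iff_add_eq]
  rw [Finset.sum_ite_eq]
  split_ifs with h
  · rfl
  · by_contra hd
    refine h (hS (Finset.mem_biUnion.2 ⟨s, Finset.mem_univ s, Finset.mem_image.2 ⟨d, ?_, rfl⟩⟩))
    exact mem_support_iff.2 (Ne.symm hd)

/-- The maps `proj j` project onto the members `W j` of a family of subspaces, and annihilate the
other members. -/
def IsProjectionFamily {M : Type*} [AddCommGroup M] [Module k M] (W : ℤ → Submodule k M)
    (proj : ℤ → M →+ M) : Prop :=
  ∀ i j, ∀ y ∈ W j, proj i y = if i = j then y else 0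

theorem freeComponent_isProjectionFamily (b : Fin r → ℤ) :
    IsProjectionFamily (freeDegree k n b) fun j => (freeComponent k n b j).toAddMonoidHom := by
  intro i j y hy
  funext s
  change weightedHomogeneousComponent _ _ (y s) = _
  rw [weightedHomogeneousComponent_of_mem (hy s)]
  by_cases h : i = j
  · rw [if_pos h, if_pos (by rw [h])]
  · rw [if_neg h, if_neg (fun h' => h (sub_left_injective h'.symm).symm)]; rfl

variable {M : Type*} [AddCommGroup M] [Module k M] {W : ℤ → Submodule k M}
  [Module (MvPolynomial (Fin n) k) M]

/-- An element of the free module is a finite sum of its components, and `proj j` kills the images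
of all but the `j`-th. No direct sum decomposition of `M` is required. -/
theorem map_freeComponent {proj : ℤ → M →+ M} (hW : IsProjectionFamily W proj) {b : Fin r → ℤ}
    (φ : (Fin r → MvPolynomial (Fin n) k) →ₗ[MvPolynomial (Fin n) k] M)
    (hφ : ∀ j, ∀ f ∈ freeDegree k n b j, φ f ∈ W j) (j : ℤ) (f : Fin r → MvPolynomial (Fin n) k) :
    φ (freeComponent k n b j f) = proj j (φ f) := by
  classical
  obtain ⟨S, hS⟩ := exists_sum_freeComponent b f
  conv_rhs => rw [← hS (insert j S) (Finset.subset_insert _ _), map_sum, map_sum]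
  rw [Finset.sum_congr rfl fun i _ => hW j i _ (hφ i _ (freeComponent_mem b i f)),
    Finset.sum_ite_eq, if_pos (Finset.mem_insert_self _ _)]

/-- Elements of degree `j` in the range of a homogeneous map come from elements of degree `j`. -/
theorem exists_mem_freeDegree_of_mem_range {proj : ℤ → M →+ M} (hW : IsProjectionFamily W proj)
    {b : Fin r → ℤ} (φ : (Fin r → MvPolynomial (Fin n) k) →ₗ[MvPolynomial (Fin n) k] M)
    (hφ : ∀ j, ∀ f ∈ freeDegree k n b j, φ f ∈ W j) {j : ℤ} {y : M} (hy : y ∈ W j)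
    (hr : y ∈ LinearMap.range φ) : ∃ f ∈ freeDegree k n b j, φ f = y := by
  obtain ⟨f, rfl⟩ := hr
  refine ⟨_, freeComponent_mem b j f, ?_⟩
  rw [map_freeComponent hW φ hφ, hW j j _ hy, if_pos rfl]

theorem maxIdeal_le_ker_constantCoeff {f : MvPolynomial (Fin n) k} (hf : f ∈ maxIdeal k n) :
    constantCoeff f = 0 := by
  have : maxIdeal k n ≤ RingHom.ker (constantCoeff (R := k) (σ := Fin n)) := by
    rw [Ideal.span_le]
    rintro _ ⟨s, rfl⟩
    exact constantCoeff_X k s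
  exact this hf

theorem mem_maxIdeal_of_constantCoeff {f : MvPolynomial (Fin n) k} (hf : constantCoeff f = 0) :
    f ∈ maxIdeal k n := by
  rw [maxIdeal, ← Set.image_univ, mem_ideal_span_X_image]
  intro d hd
  have : d ≠ 0 := by rintro rfl; exact mem_support_iff.1 hd hf
  obtain ⟨s, hs⟩ := Finsupp.ne_iff.1 this
  exact ⟨s, Set.mem_univ s, hs⟩

theorem mem_maxIdeal_smul_top_iff {f : Fin r → MvPolynomial (Fin n) k} :
    f ∈ maxIdeal k n • (⊤ : Submodule (MvPolynomial (Fin n) k) (Fin r → MvPolynomial (Fin n) k)) ↔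
      ∀ s, constantCoeff (f s) = 0 := by
  constructor
  · intro hf s
    refine Submodule.smul_induction_on hf (fun c hc g _ => ?_) (fun g h hg hh => ?_)
    · rw [Pi.smul_apply, smul_eq_mul, map_mul, maxIdeal_le_ker_constantCoeff hc, zero_mul]
    · rw [Pi.add_apply, map_add, hg, hh, add_zero]
  · intro hf
    rw [pi_eq_sum_univ' f]
    exact sum_mem fun s _ => Submodule.smul_mem_smul (mem_maxIdeal_of_constantCoeff (hf s))
      Submodule.mem_top

end Components

/-! ### Betti numbers as Koszul homology, and the syzygy theorem. -/

section Resolution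

open MvPolynomial

/-- A minimal graded free resolution whose length is not required to be finite. -/
structure InfiniteResolution (k : Type*) [Field k] (n : ℕ) (M : Type*)
    [AddCommGroup M] [Module k M] [Module (MvPolynomial (Fin n) k) M]
    (W : ℤ → Submodule k M) where
  rank : ℕ → ℕ
  deg : ∀ i, Fin (rank i) → ℤ
  d : ∀ i, (Fin (rank (i + 1)) → MvPolynomial (Fin n) k) →ₗ[MvPolynomial (Fin n) k]
    (Fin (rank i) → MvPolynomial (Fin n) k)
  ε : (Fin (rank 0) → MvPolynomial (Fin n) k) →ₗ[MvPolynomial (Fin n) k] M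
  d_mem : ∀ i j, ∀ f ∈ freeDegree k n (deg (i + 1)) j, d i f ∈ freeDegree k n (deg i) j
  ε_mem : ∀ j, ∀ f ∈ freeDegree k n (deg 0) j, ε f ∈ W j
  minimal : ∀ i f s, constantCoeff (d i f s) = 0
  exact : ∀ i, Function.Exact (d (i + 1)) (d i)
  exact_zero : Function.Exact (d 0) ε
  ε_surjective : Function.Surjective ε

variable {k : Type*} [Field k] {n : ℕ} {M : Type*} [AddCommGroup M] [Module k M]
  [Module (MvPolynomial (Fin n) k) M] {W : ℤ → Submodule k M}

namespace InfiniteResolution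

variable (F : InfiniteResolution k n M W)

/-- The image of `d l` is resolved by the free modules from index `l + 1` on. Each shift passes to
the next syzygy, so `l` varies in the induction, and after `i` shifts only zeroth homology remains.
-/
theorem koszulNumber_map_d (i l : ℕ) (j : ℤ) :
    koszulNumber n (fun j => (freeDegree k n (F.deg (l + 1)) j).map
      ((F.d l).restrictScalars k)) i j =
      Fintype.card {s : Fin (F.rank (l + 1 + i)) // F.deg (l + 1 + i) s = j} := by
  have hmin : ∀ l, ∀ f, F.d l f = 0 → ∀ s, constantCoeff (f s) = 0 := fun l f hf s => by
    obtain ⟨g, rfl⟩ := (F.exact l f).1 hf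
    exact F.minimal _ g s
  induction i generalizing l with
  | zero => exact koszulNumber_zero (F.d l) (hmin l) j
  | succ i ih =>
    rw [koszulNumber_shift (F.d l) (hmin l)]
    have : (fun j => freeDegree k n (F.deg (l + 1)) j ⊓ LinearMap.ker ((F.d l).restrictScalars k)) =
        fun j => (freeDegree k n (F.deg (l + 1 + 1)) j).map ((F.d (l + 1)).restrictScalars k) := by
      funext j
      apply le_antisymm
      · rintro f ⟨hf, hf'⟩
        exact exists_mem_freeDegree_of_mem_range (freeComponent_isProjectionFamily _) _
          (F.d_mem (l + 1)) hf ((F.exact l f).1 hf')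
      · rintro _ ⟨f, hf, rfl⟩
        exact ⟨F.d_mem _ _ _ hf, (F.exact l _).2 ⟨f, rfl⟩⟩
    rw [this, ih (l + 1), show l + 1 + 1 + i = l + 1 + (i + 1) by omega]

theorem eq_map_ε [IsScalarTower k (MvPolynomial (Fin n) k) M]
    {proj : ℤ → M →+ M} (hW : IsProjectionFamily W proj) :
    W = fun j => (freeDegree k n (F.deg 0) j).map (F.ε.restrictScalars k) := by
  funext j
  apply le_antisymm
  · intro y hy
    exact exists_mem_freeDegree_of_mem_range hW F.ε F.ε_mem hy (F.ε_surjective y)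
  · rintro _ ⟨f, hf, rfl⟩
    exact F.ε_mem j f hf

theorem finiteDimensional (F : InfiniteResolution k n M W)
    [IsScalarTower k (MvPolynomial (Fin n) k) M] {proj : ℤ → M →+ M}
    (hW : IsProjectionFamily W proj) (j : ℤ) :
    FiniteDimensional k (W j) := by
  rw [congrFun (F.eq_map_ε hW) j]
  infer_instance

/-- The graded Betti numbers are the dimensions of Koszul homology. -/
theorem koszulNumber_eq [IsScalarTower k (MvPolynomial (Fin n) k) M]
    {proj : ℤ → M →+ M} (hW : IsProjectionFamily W proj) (i : ℕ) (j : ℤ) :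
    koszulNumber n W i j = Fintype.card {s : Fin (F.rank i) // F.deg i s = j} := by
  have hmin : ∀ f, F.ε f = 0 → ∀ s, constantCoeff (f s) = 0 := fun f hf s => by
    obtain ⟨g, rfl⟩ := (F.exact_zero f).1 hf
    exact F.minimal _ g s
  have hK : koszulNumber n W i j = koszulNumber n
      (fun j => (freeDegree k n (F.deg 0) j).map (F.ε.restrictScalars k)) i j :=
    congrArg (fun W => koszulNumber n W i j) (F.eq_map_ε hW)
  rw [hK]
  rcases i with _ | i
  · exact koszulNumber_zero F.ε hmin j
  · rw [koszulNumber_shift F.ε hmin]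
    have : (fun j => freeDegree k n (F.deg 0) j ⊓ LinearMap.ker (F.ε.restrictScalars k)) =
        fun j => (freeDegree k n (F.deg 1) j).map ((F.d 0).restrictScalars k) := by
      funext j
      apply le_antisymm
      · rintro f ⟨hf, hf'⟩
        exact exists_mem_freeDegree_of_mem_range (freeComponent_isProjectionFamily _) _
          (F.d_mem 0) hf ((F.exact_zero f).1 hf')
      · rintro _ ⟨f, hf, rfl⟩
        exact ⟨F.d_mem _ _ _ hf, (F.exact_zero _).2 ⟨f, rfl⟩⟩
    rw [this, F.koszulNumber_map_d i 0 j, show 0 + 1 + i = i + 1 by omega]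

/-- Hilbert's syzygy theorem. -/
theorem rank_eq_zero [IsScalarTower k (MvPolynomial (Fin n) k) M]
    {proj : ℤ → M →+ M} (hW : IsProjectionFamily W proj) {i : ℕ} (hi : n < i) :
    F.rank i = 0 := by
  by_contra h
  have s : Fin (F.rank i) := ⟨0, Nat.pos_of_ne_zero h⟩
  -- A basis vector in homological degree `i > n` would contribute to the `i`-th Koszul homology,
  -- but there are no Koszul chains in that degree.
  have := F.koszulNumber_eq hW i (F.deg i s)
  rw [koszulNumber, strand_eq_bot hi, strand_eq_bot (hi.trans (Nat.lt_succ_self i)), bot_inf_eq,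
    Submodule.map_bot, finrank_bot, sub_self] at this
  have hs : 0 < Fintype.card {s' : Fin (F.rank i) // F.deg i s' = F.deg i s} :=
    Fintype.card_pos_iff.2 ⟨⟨s, rfl⟩⟩
  omega

end InfiniteResolution

end Resolution

/-! ### Existence of minimal resolutions. -/

section Existence

open MvPolynomial

variable {k : Type*} [Field k] {n : ℕ} {M : Type*} [AddCommGroup M] [Module k M]
  [Module (MvPolynomial (Fin n) k) M]
  {W : ℤ → Submodule k M} {proj : ℤ → M →+ M}

/-- A minimal system of homogeneous generators of a finitely generated graded module. -/
theorem exists_minimal_cover (hW : IsProjectionFamily W proj)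
    (hsmul : ∀ i j, ∀ c ∈ polyDegree k n i, ∀ y ∈ W j, c • y ∈ W (i + j))
    {N : Submodule (MvPolynomial (Fin n) k) M}
    (hN : ∃ S : Finset M, (∀ y ∈ S, ∃ j, y ∈ W j) ∧ Submodule.span _ (S : Set M) = N) :
    ∃ (r : ℕ) (b : Fin r → ℤ)
      (φ : (Fin r → MvPolynomial (Fin n) k) →ₗ[MvPolynomial (Fin n) k] M),
      (∀ j, ∀ f ∈ freeDegree k n b j, φ f ∈ W j) ∧ LinearMap.range φ = N ∧
      ∀ f, φ f = 0 → ∀ s, constantCoeff (f s) = 0 := by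
  classical
  -- The cover uses the least possible number of homogeneous generators.
  let P : ℕ → Prop := fun r => ∃ (b : Fin r → ℤ) (v : Fin r → M), (∀ s, v s ∈ W (b s)) ∧
    Submodule.span (MvPolynomial (Fin n) k) (Set.range v) = N
  have hP : ∃ r, P r := by
    obtain ⟨S, hS, hspan⟩ := hN
    choose! g hg using hS
    refine ⟨S.card, fun s => g (S.equivFin.symm s), fun s => (S.equivFin.symm s : M),
      fun s => hg _ (S.equivFin.symm s).2, ?_⟩
    rw [← hspan]
    congr 1
    ext y
    constructor
    · rintro ⟨s, rfl⟩; exact (S.equivFin.symm s).2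
    · intro hy; exact ⟨S.equivFin ⟨y, hy⟩, by simp⟩
  obtain ⟨b, v, hv, hspan⟩ := Nat.find_spec hP
  set φ := Fintype.linearCombination (MvPolynomial (Fin n) k) v with hφ
  have hφa : ∀ f, φ f = ∑ s, f s • v s := fun f => rfl
  have hdeg : ∀ j, ∀ f ∈ freeDegree k n b j, φ f ∈ W j := by
    intro j f hf
    rw [hφa]
    refine sum_mem fun s _ => ?_
    have := hsmul _ _ _ (hf s) _ (hv s)
    rwa [sub_add_cancel] at this
  refine ⟨_, b, φ, hdeg, by rw [hφ, Fintype.range_linearCombination, hspan], fun f hf s₀ => ?_⟩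
  by_contra hc
  -- The component of the relation `f` in the degree of the generator `s₀` is again a relation, and
  -- its entry at `s₀` is a nonzero constant. Solving for `v s₀` makes that generator redundant,
  -- against minimality.
  set g := freeComponent k n b (b s₀) f with hg
  have hg0 : φ g = 0 := by rw [hg, map_freeComponent hW φ hdeg, hf, map_zero]
  have hgs : g s₀ = C (constantCoeff (f s₀)) := by
    ext d
    rw [hg, freeComponent_apply, sub_self, coeff_weightedHomogeneousComponent, coeff_C]
    have hd : Finsupp.weight (fun _ : Fin n => (1 : ℤ)) d = 0 ↔ 0 = d := by
      rw [weight_one_eq_degree, Nat.cast_eq_zero, Finsupp.degree_eq_zero_iff, eq_comm]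
    simp only [hd]
    split_ifs with h
    · rw [← h]; rfl
    · rfl
  obtain ⟨m, hm⟩ : ∃ m, Nat.find hP = m + 1 := ⟨Nat.find hP - 1, by
    have := s₀.pos; omega⟩
  have hlt : m < Nat.find hP := by omega
  refine Nat.find_min hP hlt ?_
  let e : Fin (m + 1) ≃ Fin (Nat.find hP) := finCongr hm.symm
  let t : Fin m → Fin (Nat.find hP) := fun s => e ((e.symm s₀).succAbove s)
  refine ⟨b ∘ t, v ∘ t, fun s => hv _, ?_⟩
  rw [← hspan]
  have hsub : ∀ s, s ≠ s₀ → v s ∈ Submodule.span (MvPolynomial (Fin n) k) (Set.range (v ∘ t)) := by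
    intro s hs
    obtain ⟨x, hx⟩ := Fin.exists_succAbove_eq (x := e.symm s) (y := e.symm s₀)
      (fun h => hs (e.symm.injective h))
    refine Submodule.subset_span ⟨x, ?_⟩
    change v (e ((e.symm s₀).succAbove x)) = v s
    rw [hx, e.apply_symm_apply]
  apply le_antisymm
  · exact Submodule.span_mono (Set.range_comp_subset_range _ _)
  · rw [Submodule.span_le]
    rintro _ ⟨s, rfl⟩
    by_cases hs : s = s₀
    · rw [hs]
      have h1 : (C (constantCoeff (f s₀)) : MvPolynomial (Fin n) k) • v s₀ =
          -∑ s ∈ Finset.univ.erase s₀, g s • v s := by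
        rw [← hgs, eq_neg_iff_add_eq_zero, Finset.add_sum_erase _ (fun s => g s • v s)
          (Finset.mem_univ s₀)]
        exact hg0
      have h2 : v s₀ = (C (constantCoeff (f s₀))⁻¹ : MvPolynomial (Fin n) k) •
          (C (constantCoeff (f s₀)) : MvPolynomial (Fin n) k) • v s₀ := by
        rw [smul_smul, ← map_mul, inv_mul_cancel₀ hc, map_one, one_smul]
      rw [h2, h1]
      refine Submodule.smul_mem _ _ (neg_mem (sum_mem fun s hs' => Submodule.smul_mem _ _ ?_))
      exact hsub s (Finset.ne_of_mem_erase hs')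
    · exact hsub s hs

/-- A graded submodule of a graded free module has finitely many homogeneous generators. -/
theorem exists_homogeneous_generators {r : ℕ} (b : Fin r → ℤ)
    {N : Submodule (MvPolynomial (Fin n) k) (Fin r → MvPolynomial (Fin n) k)}
    (hN : ∀ f ∈ N, ∀ j, freeComponent k n b j f ∈ N) :
    ∃ S : Finset (Fin r → MvPolynomial (Fin n) k),
      (∀ y ∈ S, ∃ j, y ∈ freeDegree k n b j) ∧ Submodule.span _ (S : Set _) = N := by
  classical
  obtain ⟨T, hT⟩ := (isNoetherian_def.1 inferInstance N : N.FG)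
  choose S hS using fun f : Fin r → MvPolynomial (Fin n) k => exists_sum_freeComponent b f
  refine ⟨T.biUnion fun f => (S f).image fun j => freeComponent k n b j f, ?_, ?_⟩
  · intro y hy
    obtain ⟨f, -, hf⟩ := Finset.mem_biUnion.1 hy
    obtain ⟨j, -, rfl⟩ := Finset.mem_image.1 hf
    exact ⟨j, freeComponent_mem b j f⟩
  · apply le_antisymm
    · rw [Submodule.span_le]
      intro y hy
      obtain ⟨f, hfT, hf⟩ := Finset.mem_biUnion.1 (Finset.mem_coe.1 hy)
      obtain ⟨j, -, rfl⟩ := Finset.mem_image.1 hf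
      exact hN f (hT ▸ Submodule.subset_span hfT) j
    · rw [← hT, Submodule.span_le]
      intro f hf
      rw [← hS f (S f) subset_rfl]
      refine sum_mem fun j hj => Submodule.subset_span ?_
      exact Finset.mem_biUnion.2 ⟨f, hf, Finset.mem_image.2 ⟨j, hj, rfl⟩⟩

/-- A graded submodule of a graded free module. -/
structure GradedSubmodule (k : Type*) [Field k] (n : ℕ) where
  rank : ℕ
  deg : Fin rank → ℤ
  carrier : Submodule (MvPolynomial (Fin n) k) (Fin rank → MvPolynomial (Fin n) k)
  homogeneous : ∀ f ∈ carrier, ∀ j, freeComponent k n deg j f ∈ carrier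

theorem freeComponent_mem_ker (hW : IsProjectionFamily W proj) {r : ℕ} {b : Fin r → ℤ}
    {φ : (Fin r → MvPolynomial (Fin n) k) →ₗ[MvPolynomial (Fin n) k] M}
    (hφ : ∀ j, ∀ f ∈ freeDegree k n b j, φ f ∈ W j) :
    ∀ f ∈ LinearMap.ker φ, ∀ j, freeComponent k n b j f ∈ LinearMap.ker φ := fun f hf j => by
  rw [LinearMap.mem_ker, map_freeComponent hW φ hφ, LinearMap.mem_ker.1 hf, map_zero]

/-- The kernel is returned as a graded submodule of the new free module, so that the construction
can be iterated. -/
theorem GradedSubmodule.exists_cover (N : GradedSubmodule k n) :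
    ∃ (N' : GradedSubmodule k n)
      (φ : (Fin N'.rank → MvPolynomial (Fin n) k) →ₗ[MvPolynomial (Fin n) k]
        (Fin N.rank → MvPolynomial (Fin n) k)),
      (∀ j, ∀ f ∈ freeDegree k n N'.deg j, φ f ∈ freeDegree k n N.deg j) ∧
      LinearMap.range φ = N.carrier ∧ N'.carrier = LinearMap.ker φ ∧
      ∀ f ∈ N'.carrier, ∀ s, constantCoeff (f s) = 0 := by
  obtain ⟨r, b, φ, h₁, h₂, h₃⟩ := exists_minimal_cover
    (freeComponent_isProjectionFamily (k := k) (n := n) N.deg)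
    (fun i j c hc y hy => smul_mem_freeDegree hc hy)
    (exists_homogeneous_generators N.deg N.homogeneous)
  exact ⟨⟨r, b, LinearMap.ker φ, freeComponent_mem_ker (freeComponent_isProjectionFamily _) h₁⟩, φ,
    h₁, h₂, rfl, h₃⟩

/-- The kernel of a minimal cover. -/
def GradedSubmodule.syzygy (N : GradedSubmodule k n) : GradedSubmodule k n :=
  N.exists_cover.choose

/-- A minimal cover of a graded submodule. -/
def GradedSubmodule.cover (N : GradedSubmodule k n) :
    (Fin N.syzygy.rank → MvPolynomial (Fin n) k) →ₗ[MvPolynomial (Fin n) k]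
      (Fin N.rank → MvPolynomial (Fin n) k) :=
  N.exists_cover.choose_spec.choose

theorem GradedSubmodule.cover_mem (N : GradedSubmodule k n) :
    ∀ j, ∀ f ∈ freeDegree k n N.syzygy.deg j, N.cover f ∈ freeDegree k n N.deg j :=
  N.exists_cover.choose_spec.choose_spec.1

theorem GradedSubmodule.range_cover (N : GradedSubmodule k n) :
    LinearMap.range N.cover = N.carrier :=
  N.exists_cover.choose_spec.choose_spec.2.1

theorem GradedSubmodule.ker_cover (N : GradedSubmodule k n) :
    LinearMap.ker N.cover = N.syzygy.carrier :=
  N.exists_cover.choose_spec.choose_spec.2.2.1.symm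

theorem GradedSubmodule.exact_cover (N : GradedSubmodule k n) :
    Function.Exact N.syzygy.cover N.cover := fun f => by
  rw [← LinearMap.mem_ker, N.ker_cover, ← N.syzygy.range_cover]; rfl

theorem GradedSubmodule.constantCoeff_syzygy (N : GradedSubmodule k n) :
    ∀ f ∈ N.syzygy.carrier, ∀ s, constantCoeff (f s) = 0 :=
  N.exists_cover.choose_spec.choose_spec.2.2.2

/-- Iterated syzygies. -/
def GradedSubmodule.syzygies (N : GradedSubmodule k n) : ℕ → GradedSubmodule k n
  | 0 => N
  | i + 1 => (N.syzygies i).syzygy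

/-- Covers are iterated starting from `ker ε`. The image of each differential is the kernel of the
preceding minimal cover, hence lies in `𝔪` times the free module. -/
theorem nonempty_infiniteResolution (hW : IsProjectionFamily W proj)
    (hsmul : ∀ i j, ∀ c ∈ polyDegree k n i, ∀ y ∈ W j, c • y ∈ W (i + j))
    (hgen : ∃ S : Finset M, (∀ y ∈ S, ∃ j, y ∈ W j) ∧
      Submodule.span (MvPolynomial (Fin n) k) (S : Set M) = ⊤) :
    Nonempty (InfiniteResolution k n M W) := by
  obtain ⟨r, b, ε, h₁, h₂, h₃⟩ := exists_minimal_cover hW hsmul hgen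
  let N : GradedSubmodule k n := ⟨r, b, LinearMap.ker ε, freeComponent_mem_ker hW h₁⟩
  have hmin : ∀ i, ∀ f ∈ (N.syzygies i).carrier, ∀ s, constantCoeff (f s) = 0 := by
    intro i
    rcases i with _ | i
    · exact h₃
    · exact (N.syzygies i).constantCoeff_syzygy
  have hex : Function.Exact N.cover ε := fun f => by
    rw [← LinearMap.mem_ker, ← LinearMap.coe_range, SetLike.mem_coe, N.range_cover]
  have hsurj : Function.Surjective ε := LinearMap.range_eq_top.1 h₂
  exact ⟨{
    rank := fun i => (N.syzygies i).rank
    deg := fun i => (N.syzygies i).deg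
    d := fun i => (N.syzygies i).cover
    ε := ε
    d_mem := fun i => (N.syzygies i).cover_mem
    ε_mem := h₁
    minimal := fun i f s => hmin i _ (by
      rw [← (N.syzygies i).range_cover]; exact LinearMap.mem_range_self _ f) s
    exact := fun i => (N.syzygies i).exact_cover
    exact_zero := hex
    ε_surjective := hsurj }⟩

end Existence

/-! ### Semicontinuity of rank under reduction modulo `p`. -/

section Reduction

variable {K : Type*} [Field K] {L Vp VQ : Type*} [AddCommGroup L]
  [AddCommGroup Vp] [Module K Vp] [AddCommGroup VQ] [Module ℚ VQ]

/-- Vectors which are linearly independent in characteristic `p` are linearly independent over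
`ℚ`. -/
theorem linearIndependent_rat_of_charP (p : ℕ) [Fact p.Prime] [CharP K p]
    {Φp : L →+ Vp} {ΦQ : L →+ VQ} (hΦ : Function.Injective ΦQ)
    {ι : Type*} [Fintype ι] {v : ι → L} (hv : LinearIndependent K (Φp ∘ v)) :
    LinearIndependent ℚ (ΦQ ∘ v) := by
  rw [← LinearIndependent.iff_fractionRing ℤ ℚ, Fintype.linearIndependent_iff]
  rw [Fintype.linearIndependent_iff] at hv
  have htf : ∀ y : L, (p : ℤ) • y = 0 → y = 0 := fun y hy => by
    have h : (p : ℚ) • ΦQ y = 0 := by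
      have := congrArg ΦQ hy
      rw [map_zsmul, map_zero] at this
      rw [← this, Nat.cast_smul_eq_nsmul, natCast_zsmul]
    have hp : (p : ℚ) ≠ 0 := Nat.cast_ne_zero.2 (Fact.out : p.Prime).ne_zero
    exact hΦ (((smul_eq_zero.1 h).resolve_left hp).trans (map_zero ΦQ).symm)
  -- Descent: an integral relation becomes trivial in characteristic `p`, so `p` divides all its
  -- coefficients; as `L` has no `p`-torsion, the quotient by `p` is again a relation.
  have key : ∀ (N : ℕ) (z : ι → ℤ), ∑ c, z c • v c = 0 → ∀ c, (p : ℤ) ^ N ∣ z c := by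
    intro N
    induction N with
    | zero => intro z _ c; rw [pow_zero]; exact one_dvd _
    | succ N ih =>
      intro z hz
      have h0 : ∀ c, (p : ℤ) ∣ z c := fun c => by
        rw [← CharP.intCast_eq_zero_iff K p]
        refine hv (fun c => (z c : K)) ?_ c
        rw [← map_zero Φp, ← hz, map_sum]
        exact Finset.sum_congr rfl fun c _ => by rw [Int.cast_smul_eq_zsmul, map_zsmul]; rfl
      choose z' hz' using h0
      have hz'' : ∑ c, z' c • v c = 0 := htf _ (by
        rw [Finset.smul_sum, ← hz]
        exact Finset.sum_congr rfl fun c _ => by rw [hz' c, mul_smul])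
      intro c
      rw [hz' c, pow_succ']
      exact mul_dvd_mul_left _ (ih z' hz'' c)
  intro z hz c
  have hz0 : ∑ c, z c • v c = 0 := hΦ (by
    rw [map_sum, map_zero, ← hz]
    exact Finset.sum_congr rfl fun c _ => map_zsmul _ _ _)
  -- The exponent `|z c|` suffices since `|z c| < p ^ |z c|`.
  refine Int.eq_zero_of_dvd_of_natAbs_lt_natAbs (key (z c).natAbs z hz0 c) ?_
  rw [Int.natAbs_pow, Int.natAbs_natCast]
  exact Nat.lt_pow_self (Fact.out : p.Prime).one_lt

/-- Choose elements of `S` whose images form a basis of the span over `K`; their images over `ℚ`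
stay independent. It is used both for graded pieces and for Koszul boundaries. -/
theorem finrank_span_charP_le (p : ℕ) [Fact p.Prime] [CharP K p]
    {Φp : L →+ Vp} {ΦQ : L →+ VQ} (hΦ : Function.Injective ΦQ)
    (S : Set L) {U : Submodule ℚ VQ} [FiniteDimensional ℚ U] (hU : ∀ y ∈ S, ΦQ y ∈ U)
    [FiniteDimensional K (Submodule.span K (Φp '' S))] :
    finrank K (Submodule.span K (Φp '' S)) ≤ finrank ℚ U := by
  obtain ⟨f, hfS, -, hf⟩ := Submodule.exists_fun_fin_finrank_span_eq K (Φp '' S)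
  choose v hv hvf using hfS
  have hli := linearIndependent_rat_of_charP p (Φp := Φp) (v := v) hΦ (by
    convert hf using 1
    exact funext hvf)
  have hU' : LinearIndependent ℚ (fun x => (⟨ΦQ (v x), hU _ (hv x)⟩ : U)) :=
    LinearIndependent.of_comp (Submodule.subtype _) hli
  have h := hU'.fintype_card_le_finrank
  rwa [Fintype.card_fin] at h

end Reduction

/-! ### The grading of `A/𝔞` over the integers. -/

section Quotient

open MvPolynomial

variable {n : ℕ} (a : Ideal (MvPolynomial (Fin n) ℤ))

/-- The degree `j` part of `A/𝔞`. -/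
def quotDegree (j : ℤ) : Submodule ℤ (MvPolynomial (Fin n) ℤ ⧸ a) :=
  (polyDegree ℤ n j).map (Ideal.Quotient.mkₐ ℤ a).toLinearMap

variable {a}

theorem mem_quotDegree {j : ℤ} {y : MvPolynomial (Fin n) ℤ ⧸ a} :
    y ∈ quotDegree a j ↔ ∃ f ∈ polyDegree ℤ n j, Ideal.Quotient.mk a f = y := Iff.rfl

theorem quotDegree_finite (j : ℤ) : Module.Finite ℤ (quotDegree a j) :=
  Module.Finite.iff_fg.2 ((polyDegree_fg ℤ n j).map _)

/-- Homogeneity of the ideal refers to the grading by `ℕ`, whereas degrees here are integers; the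
components of negative degree vanish. -/
theorem weightedHomogeneousComponent_mem_of_isHomogeneous
    (ha : a.IsHomogeneous (MvPolynomial.homogeneousSubmodule (Fin n) ℤ))
    {f : MvPolynomial (Fin n) ℤ} (hf : f ∈ a) (j : ℤ) :
    weightedHomogeneousComponent (fun _ : Fin n => (1 : ℤ)) j f ∈ a := by
  by_cases hj : 0 ≤ j
  · have h := ha j.toNat hf
    have e : weightedHomogeneousComponent (fun _ : Fin n => (1 : ℤ)) j f =
        homogeneousComponent j.toNat f := by
      ext d
      rw [coeff_weightedHomogeneousComponent, coeff_homogeneousComponent,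
        weight_one_eq_degree]
      congr 1
      exact propext (by omega)
    rw [e, ← decomposition.decompose'_apply]
    exact h
  · convert zero_mem a
    ext d
    rw [coeff_weightedHomogeneousComponent, weight_one_eq_degree, if_neg (by omega), coeff_zero]

theorem exists_quotient_projection
    (ha : a.IsHomogeneous (MvPolynomial.homogeneousSubmodule (Fin n) ℤ)) :
    ∃ proj : ℤ → (MvPolynomial (Fin n) ℤ ⧸ a) →+ (MvPolynomial (Fin n) ℤ ⧸ a),
      ∀ j f, proj j (Ideal.Quotient.mk a f) =
        Ideal.Quotient.mk a (weightedHomogeneousComponent (fun _ : Fin n => (1 : ℤ)) j f) := by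
  let q := (Ideal.Quotient.mk a).toAddMonoidHom
  let g : ℤ → MvPolynomial (Fin n) ℤ →+ MvPolynomial (Fin n) ℤ ⧸ a := fun j =>
    q.comp (weightedHomogeneousComponent (fun _ : Fin n => (1 : ℤ)) j).toAddMonoidHom
  have hg : ∀ j, q.ker ≤ (g j).ker := fun j f hf =>
    Ideal.Quotient.eq_zero_iff_mem.2 (weightedHomogeneousComponent_mem_of_isHomogeneous ha
      (Ideal.Quotient.eq_zero_iff_mem.1 hf) j)
  exact ⟨fun j => q.liftOfRightInverse _
      (Function.rightInverse_surjInv (Ideal.Quotient.mk_surjective (I := a))) ⟨g j, hg j⟩,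
    fun j f => q.liftOfRightInverse_comp_apply _ _ ⟨g j, hg j⟩ f⟩

end Quotient

/-! ### The graded module `(A/𝔞) ⊗ k` and its resolution. -/

section BaseChange

open MvPolynomial

variable {n : ℕ} {a : Ideal (MvPolynomial (Fin n) ℤ)} {k : Type*} [Field k]

instance BaseChange.scalarModule : Module k (BaseChange a k) :=
  Module.compHom (R := BaseChange a k) (BaseChange a k) (BaseChange.ofScalar a k)

theorem scalar_smul_def (c : k) (y : BaseChange a k) : c • y = BaseChange.ofScalar a k c * y := rfl

theorem poly_smul_def (f : MvPolynomial (Fin n) k) (y : BaseChange a k) :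
    f • y = toBaseChange a k f * y := rfl

theorem toBaseChange_C (c : k) : toBaseChange a k (C c) = BaseChange.ofScalar a k c :=
  eval₂_C _ _ _

theorem toBaseChange_X (i : Fin n) :
    toBaseChange a k (X i) = BaseChange.ofQuotient a k (Ideal.Quotient.mk a (X i)) :=
  eval₂_X _ _ _

theorem toBaseChange_map (f : MvPolynomial (Fin n) ℤ) :
    toBaseChange a k (map (Int.castRingHom k) f) =
      BaseChange.ofQuotient a k (Ideal.Quotient.mk a f) := by
  have : (toBaseChange a k).comp (map (Int.castRingHom k)) =
      (BaseChange.ofQuotient a k).comp (Ideal.Quotient.mk a) := by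
    refine MvPolynomial.ringHom_ext (fun z => ?_) (fun i => ?_)
    · rw [RingHom.comp_apply, RingHom.comp_apply, map_C, toBaseChange_C, eq_intCast, map_intCast,
        show (C z : MvPolynomial (Fin n) ℤ) = (z : MvPolynomial (Fin n) ℤ) from rfl,
        map_intCast, map_intCast]
    · rw [RingHom.comp_apply, RingHom.comp_apply, map_X, toBaseChange_X]
  exact RingHom.congr_fun this f

instance BaseChange.isScalarTower : IsScalarTower k (MvPolynomial (Fin n) k) (BaseChange a k) where
  smul_assoc c f y := by
    rw [poly_smul_def, poly_smul_def, scalar_smul_def, smul_eq_C_mul, map_mul, toBaseChange_C,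
      mul_assoc]

theorem ofQuotient_mul_ofScalar (y : MvPolynomial (Fin n) ℤ ⧸ a) (c : k) :
    BaseChange.ofQuotient a k y * BaseChange.ofScalar a k c =
      (y ⊗ₜ[ℤ] c : (MvPolynomial (Fin n) ℤ ⧸ a) ⊗[ℤ] k) := by
  have h := Algebra.TensorProduct.tmul_mul_tmul (R := ℤ) y (1 : MvPolynomial (Fin n) ℤ ⧸ a)
    (1 : k) c
  rw [mul_one, one_mul] at h
  exact h

/-- The degree `j` part of `(A/𝔞) ⊗ k`, as a subspace. -/
def baseChangeSubmodule (a : Ideal (MvPolynomial (Fin n) ℤ)) (k : Type*) [Field k] (j : ℤ) :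
    Submodule k (BaseChange a k) :=
  { baseChangeDegree a k j with
    smul_mem' := fun c y hy => by
      change y ∈ baseChangeDegree a k j at hy
      change c • y ∈ baseChangeDegree a k j
      refine AddSubgroup.closure_induction ?_ ?_ ?_ ?_ hy
      · rintro _ ⟨f, hf, c', rfl⟩
        refine AddSubgroup.subset_closure ⟨f, hf, c * c', ?_⟩
        rw [scalar_smul_def, map_mul]; ring
      · rw [smul_zero]; exact zero_mem _
      · intro x y _ _ hx hy; rw [smul_add]; exact add_mem hx hy
      · intro x _ hx; rw [smul_neg]; exact neg_mem hx }

theorem mem_baseChangeSubmodule {j : ℤ} {y : BaseChange a k} :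
    y ∈ baseChangeSubmodule a k j ↔ y ∈ baseChangeDegree a k j := Iff.rfl

theorem ofQuotient_mem {j : ℤ} {y : MvPolynomial (Fin n) ℤ ⧸ a} (hy : y ∈ quotDegree a j) :
    BaseChange.ofQuotient a k y ∈ baseChangeSubmodule a k j := by
  obtain ⟨f, hf, rfl⟩ := mem_quotDegree.1 hy
  exact AddSubgroup.subset_closure ⟨f, hf, 1, by rw [map_one, mul_one]⟩

/-- This presents each graded piece as the span of the image of an integral one, the form needed for
comparing characteristics. -/
theorem baseChangeSubmodule_eq_span (j : ℤ) : baseChangeSubmodule a k j =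
    Submodule.span k (BaseChange.ofQuotient a k '' (quotDegree a j : Set _)) := by
  apply le_antisymm
  · intro y hy
    refine AddSubgroup.closure_induction ?_ ?_ ?_ ?_ (mem_baseChangeSubmodule.1 hy)
    · rintro _ ⟨f, hf, c, rfl⟩
      rw [mul_comm, ← scalar_smul_def]
      exact Submodule.smul_mem _ _ (Submodule.subset_span ⟨_, mem_quotDegree.2 ⟨f, hf, rfl⟩, rfl⟩)
    · exact zero_mem _
    · intro x y _ _ hx hy; exact add_mem hx hy
    · intro x _ hx; exact neg_mem hx
  · rw [Submodule.span_le]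
    rintro _ ⟨y, hy, rfl⟩
    exact ofQuotient_mem hy

theorem smul_mem_baseChangeSubmodule (i j : ℤ) (c : MvPolynomial (Fin n) k)
    (hc : c ∈ polyDegree k n i) (y : BaseChange a k) (hy : y ∈ baseChangeSubmodule a k j) :
    c • y ∈ baseChangeSubmodule a k (i + j) := by
  refine AddSubgroup.closure_induction ?_ ?_ ?_ ?_ (mem_baseChangeSubmodule.1 hy)
  · rintro _ ⟨f, hf, c', rfl⟩
    rw [c.as_sum, Finset.sum_smul]
    refine sum_mem fun d hd => AddSubgroup.subset_closure
      ⟨monomial d 1 * f, mul_mem_polyDegree (isWeightedHomogeneous_monomial _ _ _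
        (hc (mem_support_iff.1 hd))) hf, coeff d c * c', ?_⟩
    have e : monomial d (coeff d c) = C (coeff d c) * map (Int.castRingHom k) (monomial d 1) := by
      rw [map_monomial, map_one, C_mul_monomial, mul_one]
    rw [poly_smul_def, e, map_mul, toBaseChange_C, toBaseChange_map, map_mul, map_mul, map_mul]
    ring
  · rw [smul_zero]; exact zero_mem _
  · intro x y _ _ hx hy; rw [smul_add]; exact add_mem hx hy
  · intro x _ hx; rw [smul_neg]; exact neg_mem hx

theorem span_one_baseChange :
    Submodule.span (MvPolynomial (Fin n) k) ({1} : Set (BaseChange a k)) = ⊤ := by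
  rw [eq_top_iff]
  rintro y -
  change (MvPolynomial (Fin n) ℤ ⧸ a) ⊗[ℤ] k at y
  induction y using TensorProduct.induction_on with
  | zero => exact zero_mem _
  | tmul y c =>
    obtain ⟨f, rfl⟩ := Ideal.Quotient.mk_surjective y
    rw [← ofQuotient_mul_ofScalar]
    refine Submodule.mem_span_singleton.2 ⟨map (Int.castRingHom k) f * C c, ?_⟩
    rw [poly_smul_def, mul_one, map_mul, toBaseChange_map, toBaseChange_C]
  | add x y hx hy => exact add_mem hx hy

/-- The degree projections of `A/𝔞` are `ℤ`-linear, so they can be tensored with `k`. -/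
theorem exists_baseChange_projection
    (ha : a.IsHomogeneous (MvPolynomial.homogeneousSubmodule (Fin n) ℤ)) (k : Type*) [Field k] :
    ∃ proj : ℤ → BaseChange a k →+ BaseChange a k,
      IsProjectionFamily (baseChangeSubmodule a k) proj := by
  obtain ⟨π, hπ⟩ := exists_quotient_projection ha
  let proj : ℤ → BaseChange a k →+ BaseChange a k := fun j =>
    (((π j).toIntLinearMap.rTensor k).toAddMonoidHom :
      (MvPolynomial (Fin n) ℤ ⧸ a) ⊗[ℤ] k →+ (MvPolynomial (Fin n) ℤ ⧸ a) ⊗[ℤ] k)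
  refine ⟨proj, fun i j y hy => ?_⟩
  have hproj : ∀ b c, proj i (BaseChange.ofQuotient a k b * BaseChange.ofScalar a k c) =
      BaseChange.ofQuotient a k (π i b) * BaseChange.ofScalar a k c := fun b c => by
    rw [ofQuotient_mul_ofScalar, ofQuotient_mul_ofScalar]
    exact LinearMap.rTensor_tmul _ _ _ _
  refine AddSubgroup.closure_induction ?_ ?_ ?_ ?_ (mem_baseChangeSubmodule.1 hy)
  · rintro _ ⟨f, hf, c, rfl⟩
    rw [hproj, hπ, weightedHomogeneousComponent_of_mem hf]
    split_ifs
    · rfl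
    · rw [map_zero, map_zero, zero_mul]
  · rw [map_zero, ite_self]
  · intro x y _ _ hx hy
    rw [map_add, hx, hy]
    split_ifs
    · rfl
    · rw [add_zero]
  · intro x _ hx
    rw [map_neg, hx]
    split_ifs
    · rfl
    · rw [neg_zero]

theorem nonempty_infiniteResolution_baseChange
    (ha : a.IsHomogeneous (MvPolynomial.homogeneousSubmodule (Fin n) ℤ)) (k : Type*) [Field k] :
    Nonempty (InfiniteResolution k n (BaseChange a k) (baseChangeSubmodule a k)) := by
  obtain ⟨proj, hW⟩ := exists_baseChange_projection ha k
  refine nonempty_infiniteResolution hW smul_mem_baseChangeSubmodule ⟨{1}, ?_, ?_⟩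
  · intro y hy
    rw [Finset.mem_singleton.1 hy]
    refine ⟨0, ?_⟩
    have := ofQuotient_mem (k := k) (mem_quotDegree.2 ⟨1, isWeightedHomogeneous_one ℤ _, rfl⟩ :
      (Ideal.Quotient.mk a 1) ∈ quotDegree a 0)
    rwa [map_one, map_one] at this
  · rw [Finset.coe_singleton, span_one_baseChange]

theorem baseChangeSubmodule_finite
    (ha : a.IsHomogeneous (MvPolynomial.homogeneousSubmodule (Fin n) ℤ)) (k : Type*) [Field k]
    (j : ℤ) : FiniteDimensional k (baseChangeSubmodule a k j) := by
  obtain ⟨proj, hW⟩ := exists_baseChange_projection ha k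
  obtain ⟨F⟩ := nonempty_infiniteResolution_baseChange ha k
  exact F.finiteDimensional hW j

theorem ofQuotient_smul (t : ℕ) (y : MvPolynomial (Fin n) ℤ ⧸ a) :
    BaseChange.ofQuotient a k (variableSeq ℤ n t • y) =
      variableSeq k n t • BaseChange.ofQuotient a k y := by
  obtain ⟨f, rfl⟩ := Ideal.Quotient.mk_surjective y
  have e : map (Int.castRingHom k) (variableSeq ℤ n t) = variableSeq k n t := by
    unfold variableSeq
    split_ifs
    · exact map_X _ _
    · exact map_zero _
  rw [poly_smul_def, ← e, toBaseChange_map, ← map_mul]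
  rfl

end BaseChange

/-! ### Comparison of dimensions and ranks over `ℚ` and in characteristic `p`. -/

section Comparison

open MvPolynomial

variable {n : ℕ} {a : Ideal (MvPolynomial (Fin n) ℤ)}

theorem isTorsionFree_quotient
    (htf : ∀ m : ℤ, m ≠ 0 → ∀ y : MvPolynomial (Fin n) ℤ ⧸ a, m • y = 0 → y = 0) :
    Module.IsTorsionFree ℤ (MvPolynomial (Fin n) ℤ ⧸ a) :=
  Module.isTorsionFree_iff_smul_eq_zero.2 fun m y h => by
    by_cases hm : m = 0
    · exact Or.inl hm
    · exact Or.inr (htf m hm y h)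

/-- Torsion-free modules over `ℤ` are flat, so `ℤ → ℚ` stays injective after tensoring. -/
theorem ofQuotient_injective
    (htf : ∀ m : ℤ, m ≠ 0 → ∀ y : MvPolynomial (Fin n) ℤ ⧸ a, m • y = 0 → y = 0) :
    Function.Injective (BaseChange.ofQuotient a ℚ) := by
  have := isTorsionFree_quotient htf
  have h := Module.Flat.lTensor_preserves_injective_linearMap (M := MvPolynomial (Fin n) ℤ ⧸ a)
    (Algebra.linearMap ℤ ℚ) Int.cast_injective
  intro x y hxy
  have e : ∀ z : MvPolynomial (Fin n) ℤ ⧸ a, BaseChange.ofQuotient a ℚ z =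
      (Algebra.linearMap ℤ ℚ).lTensor _ ((TensorProduct.rid ℤ _).symm z) := fun z => by
    rw [TensorProduct.rid_symm_apply, LinearMap.lTensor_tmul, Algebra.linearMap_apply, map_one]
    rfl
  rw [e, e] at hxy
  exact (TensorProduct.rid ℤ _).symm.injective (h hxy)

/-- Tensor the right exact sequence `ℤ → ℤ → K → 0`, whose first map is multiplication by `p`. -/
theorem exists_smul_eq_of_ofQuotient_eq_zero {K : Type*} [Field K] (p : ℕ) [CharP K p]
    (hK : Function.Surjective (Int.cast : ℤ → K)) {y : MvPolynomial (Fin n) ℤ ⧸ a}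
    (hy : BaseChange.ofQuotient a K y = 0) :
    ∃ z, (p : ℤ) • z = y := by
  have hex : Function.Exact (LinearMap.lsmul ℤ ℤ (p : ℤ)) (Algebra.linearMap ℤ K) := by
    intro z
    rw [Algebra.linearMap_apply, eq_intCast, CharP.intCast_eq_zero_iff K p]
    constructor
    · rintro ⟨w, rfl⟩; exact ⟨w, rfl⟩
    · rintro ⟨w, rfl⟩; exact ⟨w, rfl⟩
  have hsurj : Function.Surjective (Algebra.linearMap ℤ K) := hK
  have h := lTensor_exact (MvPolynomial (Fin n) ℤ ⧸ a) hex hsurj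
  obtain ⟨w, hw⟩ := (h ((TensorProduct.rid ℤ _).symm y)).1 (by
    rw [TensorProduct.rid_symm_apply, LinearMap.lTensor_tmul, Algebra.linearMap_apply, map_one]
    exact hy)
  refine ⟨TensorProduct.rid ℤ _ w, ?_⟩
  have h2 : (LinearMap.lsmul ℤ ℤ (p : ℤ)).lTensor (MvPolynomial (Fin n) ℤ ⧸ a) w = (p : ℤ) • w := by
    have : LinearMap.lsmul ℤ ℤ (p : ℤ) = (p : ℤ) • LinearMap.id := rfl
    rw [this, LinearMap.lTensor_smul, LinearMap.lTensor_id]; rfl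
  rw [← map_smul, ← h2, hw, LinearEquiv.apply_symm_apply]

/-- The canonical map `A/𝔞 → (A/𝔞) ⊗ k` as an additive map. -/
def quotientHom (a : Ideal (MvPolynomial (Fin n) ℤ)) (k : Type*) [Field k] :
    (MvPolynomial (Fin n) ℤ ⧸ a) →+ BaseChange a k :=
  (BaseChange.ofQuotient a k).toAddMonoidHom

theorem finrank_charP_le_finrank_rat
    (ha : a.IsHomogeneous (MvPolynomial.homogeneousSubmodule (Fin n) ℤ))
    (htf : ∀ m : ℤ, m ≠ 0 → ∀ y : MvPolynomial (Fin n) ℤ ⧸ a, m • y = 0 → y = 0)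
    {K : Type*} [Field K] (p : ℕ) [Fact p.Prime] [CharP K p] (j : ℤ) :
    finrank K (baseChangeSubmodule a K j) ≤
      finrank ℚ (baseChangeSubmodule a ℚ j) := by
  have := baseChangeSubmodule_finite ha ℚ j
  have hp := baseChangeSubmodule_finite ha K j
  have e : baseChangeSubmodule a K j = Submodule.span K
    (quotientHom a K '' (quotDegree a j : Set _)) := baseChangeSubmodule_eq_span j
  rw [e] at hp ⊢
  have h := finrank_span_charP_le (K := K) p (Φp := quotientHom a K) (ΦQ := quotientHom a ℚ)
    (ofQuotient_injective htf) (quotDegree a j : Set _) fun y hy => ofQuotient_mem hy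
  exact h

/-- The integral graded piece is finitely generated and torsion-free, hence free. Its basis spans
over `ℚ` and stays independent over `K`. -/
theorem finrank_rat_le_finrank_charP
    (ha : a.IsHomogeneous (MvPolynomial.homogeneousSubmodule (Fin n) ℤ))
    (htf : ∀ m : ℤ, m ≠ 0 → ∀ y : MvPolynomial (Fin n) ℤ ⧸ a, m • y = 0 → y = 0)
    {K : Type*} [Field K] (p : ℕ) [CharP K p]
    (hK : Function.Surjective (Int.cast : ℤ → K)) (j : ℤ) :
    finrank ℚ (baseChangeSubmodule a ℚ j) ≤
      finrank K (baseChangeSubmodule a K j) := by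
  have := isTorsionFree_quotient htf
  have := quotDegree_finite (a := a) j
  have := baseChangeSubmodule_finite ha K j
  obtain ⟨π, hπ⟩ := exists_quotient_projection ha
  let e := Module.finBasis ℤ (quotDegree a j)
  have hQ : finrank ℚ (baseChangeSubmodule a ℚ j) ≤ finrank ℤ (quotDegree a j) := by
    have hspan : baseChangeSubmodule a ℚ j =
        Submodule.span ℚ (Set.range fun i => BaseChange.ofQuotient a ℚ (e i)) := by
      rw [baseChangeSubmodule_eq_span]
      apply le_antisymm
      · rw [Submodule.span_le]
        rintro _ ⟨y, hy, rfl⟩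
        have h := congrArg Subtype.val (e.sum_repr ⟨y, hy⟩)
        rw [SetLike.mem_coe, ← show _ = y from h, Submodule.coe_sum, map_sum]
        refine sum_mem fun i _ => ?_
        rw [Submodule.coe_smul, map_zsmul]
        exact zsmul_mem (Submodule.subset_span (Set.mem_range_self i)) _
      · refine Submodule.span_mono ?_
        rintro _ ⟨i, rfl⟩
        exact ⟨_, (e i).2, rfl⟩
    rw [hspan]
    refine (finrank_range_le_card _).trans ?_
    rw [Fintype.card_fin]
  refine hQ.trans ?_
  have hli : LinearIndependent K fun i =>
      (⟨BaseChange.ofQuotient a K (e i), ofQuotient_mem (e i).2⟩ :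
        baseChangeSubmodule a K j) := by
    rw [Fintype.linearIndependent_iff]
    intro c hc
    choose z hz using fun i => hK (c i)
    have h0 : BaseChange.ofQuotient a K (∑ i, z i • e i : quotDegree a j) = 0 := by
      have h := congrArg Subtype.val hc
      rw [Submodule.coe_sum] at h
      rw [Submodule.coe_sum, map_sum, ← show _ = (0 : BaseChange a K) from h]
      refine Finset.sum_congr rfl fun i _ => ?_
      rw [Submodule.coe_smul, map_zsmul, ← hz i, Int.cast_smul_eq_zsmul]
      rfl
    obtain ⟨w, hw⟩ := exists_smul_eq_of_ofQuotient_eq_zero p hK h0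
    -- The element `w` is only known to lie in `A/𝔞`. Projecting it to degree `j` allows division by
    -- `p` inside the graded piece, so `p` divides every coordinate.
    have hπj : ∀ y ∈ quotDegree a j, π j y = y := by
      intro y hy
      obtain ⟨f, hf, rfl⟩ := mem_quotDegree.1 hy
      rw [hπ, weightedHomogeneousComponent_of_mem hf, if_pos rfl]
    have hw' : (p : ℤ) • π j w = (∑ i, z i • e i : quotDegree a j) := by
      rw [← map_zsmul, hw, hπj _ (Subtype.mem _)]
    have hwm : π j w ∈ quotDegree a j := by
      obtain ⟨f, rfl⟩ := Ideal.Quotient.mk_surjective w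
      rw [hπ]
      exact mem_quotDegree.2 ⟨_, weightedHomogeneousComponent_mem _ _ _, rfl⟩
    have hsub : (p : ℤ) • (⟨π j w, hwm⟩ : quotDegree a j) = ∑ i, z i • e i := Subtype.ext hw'
    intro i
    have hi := congrArg (fun y => e.repr y i) hsub
    simp only [map_smul, Finsupp.smul_apply, e.repr_sum_self] at hi
    rw [← hz i, ← hi, smul_eq_mul, Int.cast_mul, Int.cast_natCast, CharP.cast_eq_zero, zero_mul]
  have h := hli.fintype_card_le_finrank
  rwa [Fintype.card_fin] at h

variable {k : Type*} [Field k]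

/-- The coefficientwise map from Koszul chains over `A/𝔞` to those over `(A/𝔞) ⊗ k`. -/
def chainBaseChange (a : Ideal (MvPolynomial (Fin n) ℤ)) (k : Type*) [Field k] (m : ℕ) :
    (KoszulIndex m → MvPolynomial (Fin n) ℤ ⧸ a) →+ (KoszulIndex m → BaseChange a k) :=
  (quotientHom a k).compLeft (KoszulIndex m)

theorem koszulMap_chainBaseChange (f : KoszulIndex n → MvPolynomial (Fin n) ℤ ⧸ a) :
    koszulMap k n _ (chainBaseChange a k n f) =
      chainBaseChange a k n (koszulD _ (variableSeq ℤ n) n f) :=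
  koszulD_comp (u := variableSeq ℤ n) (u' := variableSeq k n)
    (quotientHom a k) ofQuotient_smul f

theorem strand_span {B M : Type*} [AddCommGroup B] [AddCommGroup M] [Module k M] (φ : B →+ M)
    (Q : ℤ → Submodule ℤ B) (m i : ℕ) (j : ℤ) :
    strand (fun j => Submodule.span k (φ '' (Q j : Set B))) m i j =
      Submodule.span k (φ.compLeft (KoszulIndex m) '' (strand Q m i j : Set _)) := by
  classical
  apply le_antisymm
  · intro f hf
    rw [← Finset.univ_sum_single (M := fun _ => M) f]
    refine sum_mem fun s _ => ?_
    by_cases hs : s.size = i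
    · have h := (hf s).1 hs
      have hle : Submodule.span k (φ '' (Q (j - i) : Set B)) ≤
          (Submodule.span k (φ.compLeft (KoszulIndex m) '' (strand Q m i j : Set _))).comap
            (LinearMap.single k (fun _ => M) s) := by
        rw [Submodule.span_le]
        rintro _ ⟨y, hy, rfl⟩
        refine Submodule.subset_span ⟨Pi.single s y, fun t => ⟨fun ht => ?_, fun ht => ?_⟩, ?_⟩
        · by_cases hst : t = s
          · rw [hst, Pi.single_eq_same]; exact hy
          · rw [Pi.single_eq_of_ne hst]; exact zero_mem _
        · exact Pi.single_eq_of_ne (fun hst => ht (by rw [hst, hs])) _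
        · funext t
          change φ (Pi.single (M := fun _ => B) s y t) = Pi.single (M := fun _ => M) s (φ y) t
          by_cases hst : t = s
          · rw [hst, Pi.single_eq_same, Pi.single_eq_same]
          · rw [Pi.single_eq_of_ne hst, Pi.single_eq_of_ne hst, map_zero]
      exact hle h
    · rw [(hf s).2 hs, Pi.single_zero]; exact zero_mem _
  · rw [Submodule.span_le]
    rintro _ ⟨f, hf, rfl⟩ s
    refine ⟨fun hs => Submodule.subset_span ⟨f s, (hf s).1 hs, rfl⟩, fun hs => ?_⟩
    change φ (f s) = 0
    rw [(hf s).2 hs, map_zero]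

theorem strand_baseChange_eq_span (m i : ℕ) (j : ℤ) :
    strand (baseChangeSubmodule a k) m i j =
      Submodule.span k (chainBaseChange a k m '' (strand (quotDegree a) m i j : Set _)) := by
  have h : baseChangeSubmodule a k =
      fun j => Submodule.span k (quotientHom a k '' (quotDegree a j : Set _)) :=
    funext baseChangeSubmodule_eq_span
  rw [h]
  exact strand_span (quotientHom a k) (quotDegree a) m i j

theorem map_koszulMap_strand_eq_span (i : ℕ) (j : ℤ) :
    (strand (baseChangeSubmodule a k) n i j).map (koszulMap k n _) =
      Submodule.span k (chainBaseChange a k n ''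
        (koszulD _ (variableSeq ℤ n) n '' (strand (quotDegree a) n i j : Set _))) := by
  rw [strand_baseChange_eq_span, Submodule.map_span, Set.image_image, Set.image_image]
  simp only [koszulMap_chainBaseChange]

theorem finrank_koszul_charP_le_rat
    (ha : a.IsHomogeneous (MvPolynomial.homogeneousSubmodule (Fin n) ℤ))
    (htf : ∀ m : ℤ, m ≠ 0 → ∀ y : MvPolynomial (Fin n) ℤ ⧸ a, m • y = 0 → y = 0)
    {K : Type*} [Field K] (p : ℕ) [Fact p.Prime] [CharP K p] (i : ℕ) (j : ℤ) :
    finrank K ((strand (baseChangeSubmodule a K) n i j).map (koszulMap _ n _)) ≤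
      finrank ℚ ((strand (baseChangeSubmodule a ℚ) n i j).map (koszulMap _ n _)) := by
  have := baseChangeSubmodule_finite ha ℚ
  have := baseChangeSubmodule_finite ha K
  have hp : FiniteDimensional K
    ((strand (baseChangeSubmodule a K) n i j).map (koszulMap _ n _)) := inferInstance
  rw [map_koszulMap_strand_eq_span] at hp ⊢
  refine finrank_span_charP_le (K := K) p (Φp := chainBaseChange a K n)
    (ΦQ := chainBaseChange a ℚ n) (fun f g hfg => ?_) _ ?_
  · funext s
    exact ofQuotient_injective htf (congrFun hfg s)
  · intro y hy
    rw [map_koszulMap_strand_eq_span]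
    exact Submodule.subset_span ⟨y, hy, rfl⟩

end Comparison

/-! ### Combinatorics of consecutive cancellations. -/

section Cancellation

/-- The multiset lists the cancellations to perform: an element `(i, j)` removes one from the
entries at `(i, j)` and `(i + 1, j)`. -/
theorem obtainedByCancellations_of_multiset (m : Multiset (ℕ × ℤ)) :
    ∀ {β β' : ℕ → ℤ → ℕ}, (∀ j, β 0 j = β' 0 j + m.count (0, j)) →
      (∀ i j, β (i + 1) j = β' (i + 1) j + m.count (i + 1, j) + m.count (i, j)) →
      ObtainedByCancellations β β' := by
  induction m using Multiset.induction_on with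
  | empty =>
    intro β β' h₀ h₁
    have : β = β' := by
      funext i j
      rcases i with _ | i
      · simpa using h₀ j
      · simpa using h₁ i j
    rw [this]
    exact Relation.ReflTransGen.refl
  | cons x m ih =>
    obtain ⟨i, j⟩ := x
    intro β β' h₀ h₁
    -- `γ` is the table just before the last cancellation: `β'` with one pair put back.
    let γ : ℕ → ℤ → ℕ := fun u v =>
      β' u v + if (u, v) = (i, j) ∨ (u, v) = (i + 1, j) then 1 else 0
    refine Relation.ReflTransGen.tail (b := γ) (ih (fun v => ?_) (fun u v => ?_)) ⟨i, j, ?_, ?_, ?_⟩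
    · rw [h₀ v, Multiset.count_cons]
      simp only [γ, Prod.mk.injEq]
      split_ifs <;> first | omega | tauto
    · rw [h₁ u v, Multiset.count_cons, Multiset.count_cons]
      simp only [γ, Prod.mk.injEq]
      split_ifs <;> omega
    · simp [γ]
    · simp [γ]
    · intro u v h h'
      simp only [γ]
      rw [if_neg (not_or.2 ⟨h, h'⟩), add_zero]

/-- The hypotheses force `r ≤ β` entrywise, so `r` has finite support and is the multiplicity
function of a multiset. -/
theorem obtainedByCancellations_of_finite {β β' r : ℕ → ℤ → ℕ}
    (hfin : {x : ℕ × ℤ | β x.1 x.2 ≠ 0}.Finite) (h₀ : ∀ j, β 0 j = β' 0 j + r 0 j)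
    (h₁ : ∀ i j, β (i + 1) j = β' (i + 1) j + r (i + 1) j + r i j) :
    ObtainedByCancellations β β' := by
  classical
  have hr : ∀ x : ℕ × ℤ, r x.1 x.2 ≠ 0 → β x.1 x.2 ≠ 0 := by
    rintro ⟨i, j⟩ h
    rcases i with _ | i
    · have := h₀ j; simp only at h ⊢; omega
    · have := h₁ i j; simp only at h ⊢; omega
  let m : ℕ × ℤ →₀ ℕ := Finsupp.onFinset hfin.toFinset (fun x => r x.1 x.2) fun x hx =>
    hfin.mem_toFinset.2 (hr x hx)
  have hm : ∀ i j, (Finsupp.toMultiset m).count (i, j) = r i j := fun i j => by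
    rw [Finsupp.count_toMultiset]; rfl
  refine obtainedByCancellations_of_multiset (Finsupp.toMultiset m) (fun j => ?_) (fun i j => ?_)
  · rw [hm, h₀]
  · rw [hm, hm, h₁]

end Cancellation

/-! ### Assembling the Betti tables. -/

namespace MinimalGradedFreeResolution

open MvPolynomial

variable {n : ℕ} {a : Ideal (MvPolynomial (Fin n) ℤ)} {k : Type*} [Field k]

/-- Forget that the length is finite. -/
def toInfiniteResolution
    (F : MinimalGradedFreeResolution k n (BaseChange a k) (baseChangeDegree a k)) :
    InfiniteResolution k n (BaseChange a k) (baseChangeSubmodule a k) where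
  rank := F.rank
  deg := F.deg
  d := F.d
  ε := F.ε
  d_mem := F.d_degree_zero
  ε_mem := F.ε_degree_zero
  minimal i f := mem_maxIdeal_smul_top_iff.1 (F.minimal i ⟨f, rfl⟩)
  exact := F.exact
  exact_zero := F.exact_zero
  ε_surjective := F.ε_surjective

theorem koszulNumber_eq_betti
    (ha : a.IsHomogeneous (MvPolynomial.homogeneousSubmodule (Fin n) ℤ))
    (F : MinimalGradedFreeResolution k n (BaseChange a k) (baseChangeDegree a k)) (i : ℕ) (j : ℤ) :
    koszulNumber n (baseChangeSubmodule a k) i j = F.betti i j := by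
  obtain ⟨proj, hW⟩ := exists_baseChange_projection ha k
  exact F.toInfiniteResolution.koszulNumber_eq hW i j

theorem finite_betti_ne_zero
    (F : MinimalGradedFreeResolution k n (BaseChange a k) (baseChangeDegree a k)) :
    {x : ℕ × ℤ | F.betti x.1 x.2 ≠ 0}.Finite := by
  obtain ⟨N, hN⟩ := F.finite_length
  refine ((Finset.range (N + 1)).finite_toSet.biUnion
    fun i _ => Set.finite_range fun s : Fin (F.rank i) => (i, F.deg i s)).subset ?_
  rintro ⟨i, j⟩ hx
  obtain ⟨s, hs⟩ := Fintype.card_pos_iff.1 (Nat.pos_of_ne_zero hx)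
  have hs' : F.deg i s = j := hs
  refine Set.mem_biUnion (x := i) ?_ ⟨s, Prod.ext rfl hs'⟩
  rw [Finset.mem_coe, Finset.mem_range]
  by_contra h
  have h0 : F.rank i = 0 := hN i (by omega)
  have h1 : 0 < F.rank i := s.pos
  omega

end MinimalGradedFreeResolution

theorem nonempty_minimalGradedFreeResolution {n : ℕ} {a : Ideal (MvPolynomial (Fin n) ℤ)}
    (ha : a.IsHomogeneous (MvPolynomial.homogeneousSubmodule (Fin n) ℤ)) (k : Type*) [Field k] :
    Nonempty (MinimalGradedFreeResolution k n (BaseChange a k) (baseChangeDegree a k)) := by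
  obtain ⟨proj, hW⟩ := exists_baseChange_projection ha k
  obtain ⟨F⟩ := nonempty_infiniteResolution_baseChange ha k
  exact ⟨{
    rank := F.rank
    deg := F.deg
    d := F.d
    ε := F.ε
    d_degree_zero := F.d_mem
    ε_degree_zero := F.ε_mem
    minimal := fun i => by
      rintro _ ⟨f, rfl⟩
      exact mem_maxIdeal_smul_top_iff.2 (F.minimal i f)
    exact := F.exact
    exact_zero := F.exact_zero
    ε_surjective := F.ε_surjective
    finite_length := ⟨n, fun _ hi => F.rank_eq_zero hW hi⟩ }⟩

/-- Homology is expressed through chain dimensions, which agree over `ℚ` and `𝔽_p`, and ranks, which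
are compared by an inequality. -/
theorem koszulNumber_eq_finrank_sub {n : ℕ} {k M : Type*} [Field k] [AddCommGroup M] [Module k M]
    [Module (MvPolynomial (Fin n) k) M] [IsScalarTower k (MvPolynomial (Fin n) k) M]
    (W : ℤ → Submodule k M) [∀ j, FiniteDimensional k (W j)] (i : ℕ) (j : ℤ) :
    koszulNumber n W i j = finrank k (strand W n i j) -
      finrank k ((strand W n i j).map (koszulMap k n M)) -
      finrank k ((strand W n (i + 1) j).map (koszulMap k n M)) := by
  have := finrank_map_add_finrank_inf_ker (strand W n i j) (koszulMap k n M)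
  unfold koszulNumber
  omega

theorem finrank_map_koszulMap_zero {n : ℕ} {k M : Type*} [Field k] [AddCommGroup M] [Module k M]
    [Module (MvPolynomial (Fin n) k) M] [IsScalarTower k (MvPolynomial (Fin n) k) M]
    (W : ℤ → Submodule k M) (j : ℤ) :
    finrank k ((strand W n 0 j).map (koszulMap k n M)) = 0 := by
  have : (strand W n 0 j).map (koszulMap k n M) = ⊥ := by
    rw [eq_bot_iff]
    rintro _ ⟨f, hf, rfl⟩
    exact (Submodule.mem_bot k).2 (koszulD_strand_zero hf)
  rw [this, finrank_bot]

theorem obtainedByCancellations_betti {n : ℕ} {a : Ideal (MvPolynomial (Fin n) ℤ)}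
    (ha : a.IsHomogeneous (MvPolynomial.homogeneousSubmodule (Fin n) ℤ))
    (htf : ∀ m : ℤ, m ≠ 0 → ∀ y : MvPolynomial (Fin n) ℤ ⧸ a, m • y = 0 → y = 0)
    {K : Type*} [Field K] (p : ℕ) [Fact p.Prime] [CharP K p]
    (hK : Function.Surjective (Int.cast : ℤ → K))
    (F : MinimalGradedFreeResolution ℚ n (BaseChange a ℚ) (baseChangeDegree a ℚ))
    (G : MinimalGradedFreeResolution K n (BaseChange a K)
      (baseChangeDegree a K)) :
    ObtainedByCancellations G.betti F.betti := by
  have := baseChangeSubmodule_finite ha ℚ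
  have := baseChangeSubmodule_finite ha K
  have ht : ∀ i j, finrank ℚ (strand (baseChangeSubmodule a ℚ) n i j) =
      finrank K (strand (baseChangeSubmodule a K) n i j) := fun i j => by
    rw [finrank_strand, finrank_strand, le_antisymm (finrank_rat_le_finrank_charP ha htf p hK (j - i))
      (finrank_charP_le_finrank_rat ha htf p (j - i))]
  -- `r i j` is the rank lost modulo `p` by the differential from `(i + 1)`-chains to `i`-chains.
  -- The truncated subtraction is a true one by `finrank_koszul_charP_le_rat`.
  refine obtainedByCancellations_of_finite (r := fun i j =>
    finrank ℚ ((strand (baseChangeSubmodule a ℚ) n (i + 1) j).map (koszulMap _ n _)) -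
      finrank K ((strand (baseChangeSubmodule a K) n (i + 1) j).map
        (koszulMap _ n _))) G.finite_betti_ne_zero (fun j => ?_) (fun i j => ?_)
  · have hF := F.koszulNumber_eq_betti ha 0 j
    have hG := G.koszulNumber_eq_betti ha 0 j
    rw [koszulNumber_eq_finrank_sub, finrank_map_koszulMap_zero] at hF hG
    have h := ht 0 j
    have h1 := finrank_koszul_charP_le_rat (K := K) ha htf p (0 + 1) j
    omega
  · have hF := F.koszulNumber_eq_betti ha (i + 1) j
    have hG := G.koszulNumber_eq_betti ha (i + 1) j
    rw [koszulNumber_eq_finrank_sub] at hF hG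
    have h := ht (i + 1) j
    have h1 := finrank_koszul_charP_le_rat (K := K) ha htf p (i + 1) j
    have h2 := finrank_koszul_charP_le_rat (K := K) ha htf p (i + 1 + 1) j
    omega

end BettiCancellation

end

theorem mainTheorem4 (n : ℕ) (a : Ideal (MvPolynomial (Fin n) ℤ))
    (ha : a.IsHomogeneous (MvPolynomial.homogeneousSubmodule (Fin n) ℤ))
    (htf : ∀ m : ℤ, m ≠ 0 → ∀ y : MvPolynomial (Fin n) ℤ ⧸ a, m • y = 0 → y = 0)
    (p : ℕ) [Fact p.Prime] :
    Nonempty (BettiCancellation.MinimalGradedFreeResolution ℚ n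
      (BettiCancellation.BaseChange a ℚ) (BettiCancellation.baseChangeDegree a ℚ)) ∧
    Nonempty (BettiCancellation.MinimalGradedFreeResolution (ZMod p) n
      (BettiCancellation.BaseChange a (ZMod p))
      (BettiCancellation.baseChangeDegree a (ZMod p))) ∧
    ∀ (F : BettiCancellation.MinimalGradedFreeResolution ℚ n
        (BettiCancellation.BaseChange a ℚ) (BettiCancellation.baseChangeDegree a ℚ))
      (G : BettiCancellation.MinimalGradedFreeResolution (ZMod p) n
        (BettiCancellation.BaseChange a (ZMod p))
        (BettiCancellation.baseChangeDegree a (ZMod p))),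
      BettiCancellation.ObtainedByCancellations G.betti F.betti :=
  ⟨BettiCancellation.nonempty_minimalGradedFreeResolution ha ℚ,
    BettiCancellation.nonempty_minimalGradedFreeResolution ha (ZMod p),
    BettiCancellation.obtainedByCancellations_betti (K := ZMod p) ha htf p ZMod.intCast_surjective⟩
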